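/- **Setting.** Let $x_{t+1}=Ax_t+w_t$ ($t\ge 0$) and $y_t=Cx_t+v_t$ ($t\ge 1$), with $x_t\in\mathbb R^{n_x}$, $y_t\in\mathbb R^{n_y}$, where $w_t\sim\mathcal N(0,Q)$ and $v_t\sim\mathcal N(0,R)$ are white and mutually uncorrelated and $x_0\sim\mathcal N(\bar x_0,\bar P_0)$ with $\bar P_0$ positive definite. The covariances $Q,R$ are unknown, but $Q\in\mathcal Q$, $R\in\mathcal R$, where $\mathcal Q,\mathcal R$ are given measurable sets of symmetric positive definite matrices, of positive Lebesgue measure in the spaces of symmetric matrices. For symmetric positive definite $\Delta$ of size $d$ and $\gamma>d+1$ let $\mathcal W^{-1}(G;\Delta,\gamma)\propto |G|^{-(\gamma+d+1)/2}e^{-\frac12\operatorname{tr}(\Delta G^{-1})}$ be the inverse Wishart density. For a set $\mathcal S$ and a matrix function $f$ put $$\mathsf E_{\mathcal S}[f;\Delta,\gamma]=\frac{\int_{\mathcal S}f(G)\,\mathcal W^{-1}(G;\Delta,\gamma)\,dG}{\int_{\mathcal S}\mathcal W^{-1}(G;\Delta,\gamma)\,dG}.$$ **The VB-MHE filter.**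 Fix integers $T\ge 1$ (window length), $N\ge 1$ (variational iterations), $\rho\in(0,1)$, positive definite $\bar M_0,\bar S_0$, and $\bar m_0>n_x+1$, $\bar s_0>n_y+1$. Put $\Phi_{T-1}=\mathsf E_{\mathcal Q}[Q^{-1};\bar M_0,\bar m_0]$ and $\Psi_{T-1}=\mathsf E_{\mathcal R}[R^{-1};\bar S_0,\bar s_0]$. At each time $t\ge T$, given $\bar x_{t-T},\bar P_{t-T},\bar M_{t-T},\bar m_{t-T},\bar S_{t-T},\bar s_{t-T},\Phi_{t-1},\Psi_{t-1}$: (1) Set $\Phi_t^{(0)}=\Phi_{t-1}$, $\Psi_t^{(0)}=\Psi_{t-1}$, $m_t=\bar m_{t-T}+T$, $s_t=\bar s_{t-T}+T$. For $k=1,\dots,N$, with $\Phi=\Phi_t^{(k-1)}$, $\Psi=\Psi_t^{(k-1)}$: let $\hat x^{(k)}_{t-T:t}$ and $P^{(k)}_{t-T:t}$ be the minimizer and the inverse of the (constant) Hessian of $$x_{t-T:t}\mapsto\tfrac12\Big[\|x_{t-T}-\bar x_{t-T}\|^2_{\bar P_{t-T}^{-1}}+\sum_{i=t-T+1}^{t}\big(\|y_i-Cx_i\|_\Psi^2+\|x_i-Ax_{i-1}\|_\Phi^2\big)\Big],$$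 and, writing $\hat x_i,P_i,P_{i,j}$ for the blocks of $\hat x^{(k)}_{t-T:t}$ and $P^{(k)}_{t-T:t}$, $$M_t^{(k)}=\bar M_{t-T}+\sum_{i=t-T+1}^{t}\big[(\hat x_i-A\hat x_{i-1})(\hat x_i-A\hat x_{i-1})'+P_i+AP_{i-1}A'-P_{i,i-1}A'-AP_{i-1,i}\big],$$ $$S_t^{(k)}=\bar S_{t-T}+\sum_{i=t-T+1}^{t}\big[(y_i-C\hat x_i)(y_i-C\hat x_i)'+CP_iC'\big],$$ $$\Phi_t^{(k)}=\mathsf E_{\mathcal Q}[Q^{-1};M_t^{(k)},m_t],\qquad \Psi_t^{(k)}=\mathsf E_{\mathcal R}[R^{-1};S_t^{(k)},s_t].$$ Let $\hat x_{t|t}$ be the last block of $\hat x^{(N)}_{t-T:t}$, and $\Phi_t=\Phi_t^{(N)}$, $\Psi_t=\Psi_t^{(N)}$, $M_t=M_t^{(N)}$, $S_t=S_t^{(N)}$, $\hat Q_t=\mathsf E_{\mathcal Q}[Q;M_t,m_t]$, $\hat R_t=\mathsf E_{\mathcal R}[R;S_t,s_t]$. (2) Set $\tilde x=A\bar x_{t-T}$,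 $\tilde P=A\bar P_{t-T}A'+\hat Q_t$, $K=\tilde PC'(C\tilde PC'+\hat R_t)^{-1}$, $\bar P_{t-T+1}=(I-KC)\tilde P$, $\bar x_{t-T+1}=\tilde x+K(y_{t-T+1}-C\tilde x)$, $\bar M_{t-T+1}=\rho M_t$, $\bar m_{t-T+1}=\rho(m_t-n_x-1)+n_x+1$, $\bar S_{t-T+1}=\rho S_t$, $\bar s_{t-T+1}=\rho(s_t-n_y-1)+n_y+1$. Any of the means $\mathsf E_{\mathcal S}[f;\Delta,\gamma]$ may be replaced by an importance-sampling approximation $$\frac{\sum_{j=1}^{J}f(G_j)\,\frac{\mathcal W^{-1}(G_j;\Delta,\gamma)}{\pi(G_j)}\mathbf 1_{\mathcal S}(G_j)}{\sum_{j=1}^{J}\frac{\mathcal W^{-1}(G_j;\Delta,\gamma)}{\pi(G_j)}\mathbf 1_{\mathcal S}(G_j)}$$ with any number $J$ of random samples $G_j$ and any (possibly random) proposal density $\pi$, positive at the samples in $\mathcal S$, provided that almost surely at least one of the samples lies in $\mathcal S$, so that the quotient is defined. **Theorem 1.** Assume that * (A1) $(A,C)$ is detectable; * (A2) there are $0<\underline\alpha\le\overline\alpha$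 with $\underline\alpha I\le Q\le\overline\alpha I$ for all $Q\in\mathcal Q$; * (A3) there are $0<\underline\beta\le\overline\beta$ with $\underline\beta I\le R\le\overline\beta I$ for all $R\in\mathcal R$. Then the estimation error $e_t=x_t-\hat x_{t|t}$ of the VB-MHE filter is uniformly bounded in mean square: there is a constant $c$ with $E[\|e_t\|^2]\le c<\infty$ for all $t\ge T$. This holds for any number $J$ of importance samples, any number $N\ge1$ of variational iterations and any window length $T\ge1$. -/

import Mathlib

open MeasureTheory ProbabilityTheory Matrix

noncomputable section

namespace VBMHE

/-- Real square matrices of size `d`. -/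
abbrev Mat (d : ℕ) := Matrix (Fin d) (Fin d) ℝ

/-- Real (column) vectors of dimension `d`; Euclidean norms are taken through `WithLp.toLp 2`. -/
abbrev Vec (d : ℕ) := Fin d → ℝ

/-- Entrywise (Borel) measurable structure on matrices. -/
instance matMeasurableSpace (m n : Type*) : MeasurableSpace (Matrix m n ℝ) :=
  inferInstanceAs (MeasurableSpace (m → n → ℝ))

/-- Detectability of the discrete-time pair `(A, C)`: some output injection `L` makes `A - L C`
Schur stable, i.e. all its complex eigenvalues lie in the open unit disc. -/
def Detectable {nx ny : ℕ} (A : Mat nx) (C : Matrix (Fin ny) (Fin nx) ℝ) : Prop :=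
  ∃ L : Matrix (Fin nx) (Fin ny) ℝ,
    ∀ z ∈ spectrum ℂ ((A - L * C).map (algebraMap ℝ ℂ)), ‖z‖ < 1

/-- `a I ≤ G ≤ b I` in the Loewner order, for every `G` in the set `𝒮`. -/
def LoewnerBounded {d : ℕ} (𝒮 : Set (Mat d)) (a b : ℝ) : Prop :=
  ∀ G ∈ 𝒮, (G - a • (1 : Mat d)).PosSemidef ∧ (b • (1 : Mat d) - G).PosSemidef

/-! ### Inverse Wishart densities and averages with respect to them -/

/-- Lebesgue measure on symmetric `d × d` matrices: the `d (d + 1) / 2` entries on and above the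
diagonal (indexed by unordered pairs) are the coordinates. -/
def symVolume (d : ℕ) : Measure (Mat d) :=
  Measure.map (fun (u : Sym2 (Fin d) → ℝ) => (Matrix.of fun i j => u s(i, j) : Mat d)) volume

/-- The multivariate gamma function `Γ_d(a) = π^{d(d-1)/4} ∏_{j=1}^d Γ(a + (1 - j)/2)`. -/
def multivariateGamma (d : ℕ) (a : ℝ) : ℝ :=
  Real.pi ^ ((d : ℝ) * ((d : ℝ) - 1) / 4) * ∏ j : Fin d, Real.Gamma (a - (j : ℝ) / 2)

/-- The inverse Wishart density `𝒲⁻¹(G; Δ, γ)` at a positive definite matrix `G`, with scale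
matrix `Δ` and `γ` degrees of freedom. It is only evaluated at positive definite `G`. -/
def invWishart {d : ℕ} (G Δ : Mat d) (γ : ℝ) : ℝ :=
  Δ.det ^ (γ / 2) / (2 ^ (γ * d / 2) * multivariateGamma d (γ / 2)) *
    G.det ^ (-(γ + d + 1) / 2) * Real.exp (-(Δ * G⁻¹).trace / 2)

/-- `∫_𝒮 f(G) 𝒲⁻¹(G; Δ, γ) dG / ∫_𝒮 𝒲⁻¹(G; Δ, γ) dG`, the mean of the matrix-valued `f` under
the inverse Wishart distribution constrained to `𝒮`. -/
def constrainedMean {d : ℕ} (𝒮 : Set (Mat d)) (f : Mat d → Mat d) (Δ : Mat d) (γ : ℝ) : Mat d :=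
  Matrix.of fun i j =>
    (∫ G in 𝒮, f G i j * invWishart G Δ γ ∂symVolume d) /
      ∫ G in 𝒮, invWishart G Δ γ ∂symVolume d

/-- The self-normalized importance sampling approximation of `constrainedMean` with `J` samples
`G j` and proposal density `π`. -/
def importanceMean {d J : ℕ} (𝒮 : Set (Mat d)) (G : Fin J → Mat d) (π : Mat d → ℝ)
    (f : Mat d → Mat d) (Δ : Mat d) (γ : ℝ) : Mat d :=
  (∑ j, 𝒮.indicator (fun H => invWishart H Δ γ / π H) (G j))⁻¹ •
    ∑ j, 𝒮.indicator (fun H => invWishart H Δ γ / π H) (G j) • f (G j)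

/-- The way in which one constrained mean is computed: exactly, or by importance sampling. The
samples and the proposal density are random; in particular they may depend on the measurements and
on earlier outputs of the filter. -/
inductive Integrator (Ω : Type*) (d : ℕ) where
  | exact : Integrator Ω d
  | sampled (J : ℕ) (G : Fin J → Ω → Mat d) (π : Ω → Mat d → ℝ) : Integrator Ω d

/-- The value that an integrator returns on the outcome `ω`. -/
def Integrator.mean {Ω : Type*} {d : ℕ} (I : Integrator Ω d) (ω : Ω) (𝒮 : Set (Mat d))
    (f : Mat d → Mat d) (Δ : Mat d) (γ : ℝ) : Mat d :=
  match I with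
  | .exact => constrainedMean 𝒮 f Δ γ
  | .sampled _ G π => importanceMean 𝒮 (fun j => G j ω) (π ω) f Δ γ

/-- Importance sampling is meaningful: samples and proposal density are measurable and, almost
surely, the density is positive at the samples in `𝒮` and the normalizing sum is not empty, i.e. at
least one sample lies in `𝒮`. Nothing is required of the law of the samples, so that samples drawn
from `π` are a special case. -/
def Integrator.Admissible {Ω : Type*} [MeasurableSpace Ω] {d : ℕ} (I : Integrator Ω d)
    (μ : Measure Ω) (𝒮 : Set (Mat d)) : Prop :=
  match I with
  | .exact => True
  | .sampled _ G π =>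
      (∀ j, Measurable (G j)) ∧ Measurable (Function.uncurry π) ∧
        ∀ᵐ ω ∂μ, (∀ j, G j ω ∈ 𝒮 → 0 < π ω (G j ω)) ∧ ∃ j, G j ω ∈ 𝒮

/-! ### The filter -/

/-- The design data of the filter: system matrices, admissible sets of covariances, window length
`T`, number `N` of variational iterations, forgetting factor `ρ`, parameters of the priors
of `x₀`, `Q`, `R`, and the integrators used for the initial `Φ`, `Ψ`, for `Φ_t^{(k)}`, `Ψ_t^{(k)}`
(time `t`, iteration `k`) and for `Q̂_t`, `R̂_t`. -/
structure VBFilter (Ω : Type*) (nx ny : ℕ) where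
  A : Mat nx
  C : Matrix (Fin ny) (Fin nx) ℝ
  𝒬 : Set (Mat nx)
  ℛ : Set (Mat ny)
  T : ℕ
  N : ℕ
  ρ : ℝ
  x₀ : Vec nx
  P₀ : Mat nx
  M₀ : Mat nx
  m₀ : ℝ
  S₀ : Mat ny
  s₀ : ℝ
  intΦ₀ : Integrator Ω nx
  intΨ₀ : Integrator Ω ny
  intΦ : ℕ → ℕ → Integrator Ω nx
  intΨ : ℕ → ℕ → Integrator Ω ny
  intQ : ℕ → Integrator Ω nx
  intR : ℕ → Integrator Ω ny

/-- The inputs of the algorithm at time `t`, besides the measurements: `x̄, P̄, M̄, m̄, S̄, s̄` at time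
`t - T`, and `Φ_{t-1}`, `Ψ_{t-1}`. -/
structure State (nx ny : ℕ) where
  x : Vec nx
  P : Mat nx
  M : Mat nx
  m : ℝ
  S : Mat ny
  s : ℝ
  Φ : Mat nx
  Ψ : Mat ny

/-- Vectors and matrices over a window of `T + 1` states. Block `a` belongs to time `t - T + a`, so
that the blocks are in increasing order of time. -/
abbrev WinVec (T d : ℕ) := Fin (T + 1) × Fin d → ℝ

/-- See `WinVec`. -/
abbrev WinMat (T d : ℕ) := Matrix (Fin (T + 1) × Fin d) (Fin (T + 1) × Fin d) ℝ

/-- The `a`-th block of a window vector. -/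
def WinVec.block {T d : ℕ} (x : WinVec T d) (a : Fin (T + 1)) : Vec d := fun i => x (a, i)

/-- The `(a, b)` block of a window matrix. -/
def WinMat.block {T d : ℕ} (P : WinMat T d) (a b : Fin (T + 1)) : Mat d :=
  Matrix.of fun i j => P (a, i) (b, j)

namespace VBFilter

variable {Ω : Type*} {nx ny : ℕ} (F : VBFilter Ω nx ny)

/-- The blocks of `Ω_t(Ψ, Φ)`, a block tridiagonal matrix; `P` is `P̄_{t-T}`. -/
def precisionBlock (P Φ : Mat nx) (Ψ : Mat ny) (a b : Fin (F.T + 1)) : Mat nx :=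
  if a = b then
    (if (a : ℕ) = 0 then P⁻¹ else F.Cᵀ * Ψ * F.C + Φ) +
      (if (a : ℕ) < F.T then F.Aᵀ * Φ * F.A else 0)
  else if (a : ℕ) = b + 1 then -(Φ * F.A)
  else if (b : ℕ) = a + 1 then -(F.Aᵀ * Φ)
  else 0

/-- The matrix `Ω_t(Ψ, Φ)`. -/
def precision (P Φ : Mat nx) (Ψ : Mat ny) : WinMat F.T nx :=
  Matrix.of fun p q => F.precisionBlock P Φ Ψ p.1 q.1 p.2 q.2

/-- The vector `ω_t(Ψ)`: blocks `C' Ψ y_{t-T+a}` for `a ≥ 1`, and `P̄_{t-T}⁻¹ x̄_{t-T}`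
for `a = 0`. -/
def infoVec (y : ℕ → Vec ny) (t : ℕ) (st : State nx ny) (Ψ : Mat ny) : WinVec F.T nx :=
  fun p => (if (p.1 : ℕ) = 0 then st.P⁻¹ *ᵥ st.x
    else (F.Cᵀ * Ψ) *ᵥ y (t - F.T + p.1)) p.2

/-- `P_{t-T:t} = Ω_t(Ψ, Φ)⁻¹`. -/
def winCov (st : State nx ny) (Φ : Mat nx) (Ψ : Mat ny) : WinMat F.T nx :=
  (F.precision st.P Φ Ψ)⁻¹

/-- `x̂_{t-T:t} = P_{t-T:t} ω_t(Ψ)`. -/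
def winMean (y : ℕ → Vec ny) (t : ℕ) (st : State nx ny) (Φ : Mat nx) (Ψ : Mat ny) :
    WinVec F.T nx :=
  F.winCov st Φ Ψ *ᵥ F.infoVec y t st Ψ

/-- `M_t(x̂, P)`: the sum runs over the `T` transitions inside the window. -/
def scaleM (st : State nx ny) (x : WinVec F.T nx) (P : WinMat F.T nx) : Mat nx :=
  st.M + ∑ i : Fin F.T,
    (vecMulVec (x.block i.succ - F.A *ᵥ x.block i.castSucc)
        (x.block i.succ - F.A *ᵥ x.block i.castSucc)
      + P.block i.succ i.succ + F.A * P.block i.castSucc i.castSucc * F.Aᵀ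
      - P.block i.succ i.castSucc * F.Aᵀ - F.A * P.block i.castSucc i.succ)

/-- `S_t(x̂, P)`: the sum runs over the `T` measurements inside the window. -/
def scaleS (y : ℕ → Vec ny) (t : ℕ) (st : State nx ny) (x : WinVec F.T nx)
    (P : WinMat F.T nx) : Mat ny :=
  st.S + ∑ i : Fin F.T,
    (vecMulVec (y (t - F.T + (i + 1)) - F.C *ᵥ x.block i.succ)
        (y (t - F.T + (i + 1)) - F.C *ᵥ x.block i.succ)
      + F.C * P.block i.succ i.succ * F.Cᵀ)

/-- `M_t` as obtained from the pair `(Φ, Ψ)` in one variational iteration. -/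
def iterM (y : ℕ → Vec ny) (t : ℕ) (st : State nx ny) (Φ : Mat nx) (Ψ : Mat ny) : Mat nx :=
  F.scaleM st (F.winMean y t st Φ Ψ) (F.winCov st Φ Ψ)

/-- `S_t` as obtained from the pair `(Φ, Ψ)` in one variational iteration. -/
def iterS (y : ℕ → Vec ny) (t : ℕ) (st : State nx ny) (Φ : Mat nx) (Ψ : Mat ny) : Mat ny :=
  F.scaleS y t st (F.winMean y t st Φ Ψ) (F.winCov st Φ Ψ)

/-- The pair `(Φ_t^{(k)}, Ψ_t^{(k)})`. -/
def variational (ω : Ω) (y : ℕ → Vec ny) (t : ℕ) (st : State nx ny) : ℕ → Mat nx × Mat ny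
  | 0 => (st.Φ, st.Ψ)
  | k + 1 =>
      let Φ := (variational ω y t st k).1
      let Ψ := (variational ω y t st k).2
      ((F.intΦ t (k + 1)).mean ω F.𝒬 (fun G => G⁻¹) (F.iterM y t st Φ Ψ) (st.m + F.T),
       (F.intΨ t (k + 1)).mean ω F.ℛ (fun G => G⁻¹) (F.iterS y t st Φ Ψ) (st.s + F.T))

/-- `Φ_t^{(N-1)}`. -/
def lastΦ (ω : Ω) (y : ℕ → Vec ny) (t : ℕ) (st : State nx ny) : Mat nx :=
  (F.variational ω y t st (F.N - 1)).1

/-- `Ψ_t^{(N-1)}`. -/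
def lastΨ (ω : Ω) (y : ℕ → Vec ny) (t : ℕ) (st : State nx ny) : Mat ny :=
  (F.variational ω y t st (F.N - 1)).2

/-- `M_t = M_t^{(N)}`. -/
def finalM (ω : Ω) (y : ℕ → Vec ny) (t : ℕ) (st : State nx ny) : Mat nx :=
  F.iterM y t st (F.lastΦ ω y t st) (F.lastΨ ω y t st)

/-- `S_t = S_t^{(N)}`. -/
def finalS (ω : Ω) (y : ℕ → Vec ny) (t : ℕ) (st : State nx ny) : Mat ny :=
  F.iterS y t st (F.lastΦ ω y t st) (F.lastΨ ω y t st)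

/-- `x̂_{t-T:t|t} = x̂_{t-T:t}^{(N)}`. -/
def finalMean (ω : Ω) (y : ℕ → Vec ny) (t : ℕ) (st : State nx ny) : WinVec F.T nx :=
  F.winMean y t st (F.lastΦ ω y t st) (F.lastΨ ω y t st)

/-- The covariance estimate `Q̂_t`. -/
def Qhat (ω : Ω) (y : ℕ → Vec ny) (t : ℕ) (st : State nx ny) : Mat nx :=
  (F.intQ t).mean ω F.𝒬 (fun G => G) (F.finalM ω y t st) (st.m + F.T)

/-- The covariance estimate `R̂_t`. -/
def Rhat (ω : Ω) (y : ℕ → Vec ny) (t : ℕ) (st : State nx ny) : Mat ny :=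
  (F.intR t).mean ω F.ℛ (fun G => G) (F.finalS ω y t st) (st.s + F.T)

/-- `P̃_{t-T+1} = A P̄_{t-T} A' + Q̂_t`. -/
def predCov (ω : Ω) (y : ℕ → Vec ny) (t : ℕ) (st : State nx ny) : Mat nx :=
  F.A * st.P * F.Aᵀ + F.Qhat ω y t st

/-- The Kalman gain `K_{t-T+1}`. -/
def gain (ω : Ω) (y : ℕ → Vec ny) (t : ℕ) (st : State nx ny) : Matrix (Fin nx) (Fin ny) ℝ :=
  F.predCov ω y t st * F.Cᵀ *
    (F.C * F.predCov ω y t st * F.Cᵀ + F.Rhat ω y t st)⁻¹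

/-- The update of the inputs of the algorithm from time `t` to time `t + 1`. -/
def update (ω : Ω) (y : ℕ → Vec ny) (t : ℕ) (st : State nx ny) : State nx ny where
  x := F.A *ᵥ st.x + F.gain ω y t st *ᵥ (y (t - F.T + 1) - F.C *ᵥ (F.A *ᵥ st.x))
  P := (1 - F.gain ω y t st * F.C) * F.predCov ω y t st
  M := F.ρ • F.finalM ω y t st
  m := F.ρ * (st.m + F.T - nx - 1) + nx + 1
  S := F.ρ • F.finalS ω y t st
  s := F.ρ * (st.s + F.T - ny - 1) + ny + 1
  Φ := (F.variational ω y t st F.N).1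
  Ψ := (F.variational ω y t st F.N).2

/-- The inputs of the algorithm at time `T + n`; at time `T` they come from the priors. -/
def state (ω : Ω) (y : ℕ → Vec ny) : ℕ → State nx ny
  | 0 =>
      { x := F.x₀, P := F.P₀, M := F.M₀, m := F.m₀, S := F.S₀, s := F.s₀
        Φ := F.intΦ₀.mean ω F.𝒬 (fun G => G⁻¹) F.M₀ F.m₀
        Ψ := F.intΨ₀.mean ω F.ℛ (fun G => G⁻¹) F.S₀ F.s₀ }
  | n + 1 => F.update ω y (F.T + n) (state ω y n)

/-- The filtered estimate `x̂_{t|t}`, for `t ≥ T`: the last block of `x̂_{t-T:t|t}`. -/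
def estimate (ω : Ω) (y : ℕ → Vec ny) (t : ℕ) : Vec nx :=
  (F.finalMean ω y t (F.state ω y (t - F.T))).block (Fin.last F.T)

/-- Standing assumptions on the design data: `𝒬`, `ℛ` are measurable sets of positive definite
matrices, of positive Lebesgue measure (so that the constrained priors exist); window length and
number of iterations are at least one; the forgetting factor is in `(0, 1)`; the priors are
nondegenerate; and all integrators are admissible. -/
structure Admissible [MeasurableSpace Ω] (μ : Measure Ω) : Prop where
  meas_𝒬 : MeasurableSet F.𝒬
  meas_ℛ : MeasurableSet F.ℛ
  posDef_𝒬 : ∀ G ∈ F.𝒬, G.PosDef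
  posDef_ℛ : ∀ G ∈ F.ℛ, G.PosDef
  vol_𝒬 : 0 < symVolume nx F.𝒬
  vol_ℛ : 0 < symVolume ny F.ℛ
  one_le_T : 1 ≤ F.T
  one_le_N : 1 ≤ F.N
  ρ_pos : 0 < F.ρ
  ρ_lt_one : F.ρ < 1
  posDef_P₀ : F.P₀.PosDef
  posDef_M₀ : F.M₀.PosDef
  posDef_S₀ : F.S₀.PosDef
  lt_m₀ : (nx : ℝ) + 1 < F.m₀
  lt_s₀ : (ny : ℝ) + 1 < F.s₀
  adm_Φ₀ : F.intΦ₀.Admissible μ F.𝒬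
  adm_Ψ₀ : F.intΨ₀.Admissible μ F.ℛ
  adm_Φ : ∀ t k, F.T ≤ t → 1 ≤ k → k ≤ F.N → (F.intΦ t k).Admissible μ F.𝒬
  adm_Ψ : ∀ t k, F.T ≤ t → 1 ≤ k → k ≤ F.N → (F.intΨ t k).Admissible μ F.ℛ
  adm_Q : ∀ t, F.T ≤ t → (F.intQ t).Admissible μ F.𝒬
  adm_R : ∀ t, F.T ≤ t → (F.intR t).Admissible μ F.ℛ

end VBFilter

/-! ### The system -/

/-- The random vectors `u`, `v` are uncorrelated: all cross-covariances of their components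
vanish. -/
def Uncorrelated {Ω : Type*} [MeasurableSpace Ω] (μ : Measure Ω) {d e : ℕ} (u : Ω → Vec d)
    (v : Ω → Vec e) : Prop :=
  ∀ i j, covariance (fun ω => u ω i) (fun ω => v ω j) μ = 0

/-- The random vector `u` has the law `𝒩(m, S)`. -/
def IsGaussianVec {Ω : Type*} [MeasurableSpace Ω] (μ : Measure Ω) {d : ℕ} (u : Ω → Vec d)
    (m : Vec d) (S : Mat d) : Prop :=
  HasLaw (fun ω => WithLp.toLp 2 (u ω)) (multivariateGaussian (WithLp.toLp 2 m) S) μ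

/-- The processes `x` (state, `t ≥ 0`) and `y` (measurements, `t ≥ 1`) follow
`x_{t+1} = A x_t + w_t`, `y_t = C x_t + v_t`, where `x₀ ~ 𝒩(x̄₀, P̄₀)` and `w_t ~ 𝒩(0, Q)`,
`v_t ~ 𝒩(0, R)` are white and uncorrelated with each other. -/
structure LinearGaussianSystem {Ω : Type*} [MeasurableSpace Ω] (μ : Measure Ω) {nx ny : ℕ}
    (A : Mat nx) (C : Matrix (Fin ny) (Fin nx) ℝ) (Q : Mat nx) (R : Mat ny)
    (x₀ : Vec nx) (P₀ : Mat nx)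
    (x : ℕ → Ω → Vec nx) (y : ℕ → Ω → Vec ny) (w : ℕ → Ω → Vec nx) (v : ℕ → Ω → Vec ny) :
    Prop where
  state_eq : ∀ t ω, x (t + 1) ω = A *ᵥ x t ω + w t ω
  meas_eq : ∀ t ω, 1 ≤ t → y t ω = C *ᵥ x t ω + v t ω
  law_x₀ : IsGaussianVec μ (x 0) x₀ P₀
  law_w : ∀ t, IsGaussianVec μ (w t) 0 Q
  law_v : ∀ t, 1 ≤ t → IsGaussianVec μ (v t) 0 R
  white_w : ∀ t s, t ≠ s → Uncorrelated μ (w t) (w s)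
  white_v : ∀ t s, 1 ≤ t → 1 ≤ s → t ≠ s → Uncorrelated μ (v t) (v s)
  uncorr : ∀ t s, 1 ≤ s → Uncorrelated μ (w t) (v s)

end VBMHE

end

/-! Every covariance or precision estimate that the filter uses is a weighted average, with
nonnegative normalized weights, over a set with Loewner bounds. It therefore obeys the same bounds
on almost every outcome, whatever the data, the samples or the number of iterations
(`Integrator.Proper.mean_between`). Given these bounds, the rest of the argument is deterministic
and pathwise, so that the dependence of the gains on the measurements does no harm.

The recursion for the prior mean is a Kalman filter with time-varying but bounded `Q̂`, `R̂`.
Detectability supplies a stabilizing gain `L` with a quadratic Lyapunov function. Since the Kalman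
gain does at least as well as `L`, the covariances `P̄` stay below a fixed multiple `p` of the
identity (`CovBound.step`, `exists_covBound`). As `Q̂` is also bounded below, the energy `(x - x̄)ᵀ
P̄⁻¹ (x - x̄)` contracts by a fixed factor at each step, up to multiples of `‖w‖²` and `‖v‖²`
(`kalman_contraction`).

The window estimate solves a least-squares problem. Its error has at most the energy of the prior
error and of the disturbances in the window (`winError_form_le`), and propagation through the `T`
transitions turns this into a bound on the last block (`exists_winError_le`). Taking means, with the
second moments of the noises independent of time, gives a geometric recursion with bounded
solutions. -/

noncomputable section

namespace VBMHE

/-! ### Quadratic forms, Young-type inequalities and the Kalman completion of squares -/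

section LinearAlgebra

lemma isSymm_of_posSemidef {n : Type*} {M : Matrix n n ℝ} (hM : M.PosSemidef) : M.IsSymm := hM.1

lemma isSymm_of_posDef {n : Type*} {M : Matrix n n ℝ} (hM : M.PosDef) : M.IsSymm := hM.1

variable {m n : Type*} [Fintype m] [Fintype n]

lemma posDef_of_form {M : Matrix n n ℝ} (hM : M.IsSymm) (h : ∀ u, u ≠ 0 → 0 < u ⬝ᵥ M *ᵥ u) :
    M.PosDef :=
  .of_dotProduct_mulVec_pos hM fun u hu => by simpa using h u hu

lemma form_pos {M : Matrix n n ℝ} (hM : M.PosDef) {u : n → ℝ} (hu : u ≠ 0) :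
    0 < u ⬝ᵥ M *ᵥ u := by
  simpa using hM.dotProduct_mulVec_pos hu

lemma form_nonneg {M : Matrix n n ℝ} (hM : M.PosSemidef) (u : n → ℝ) : 0 ≤ u ⬝ᵥ M *ᵥ u := by
  simpa using hM.dotProduct_mulVec_nonneg u

lemma dotProduct_mulVec_transpose (M : Matrix m n ℝ) (u : m → ℝ) (v : n → ℝ) :
    u ⬝ᵥ M *ᵥ v = (Mᵀ *ᵥ u) ⬝ᵥ v := by
  rw [dotProduct_mulVec, mulVec_transpose]

lemma form_comm {M : Matrix n n ℝ} (hM : M.IsSymm) (u v : n → ℝ) :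
    u ⬝ᵥ M *ᵥ v = v ⬝ᵥ M *ᵥ u := by
  rw [dotProduct_mulVec_transpose, hM.eq, dotProduct_comm]

lemma form_conj (H : Matrix m n ℝ) (P : Matrix n n ℝ) (u : m → ℝ) :
    u ⬝ᵥ (H * P * Hᵀ) *ᵥ u = (Hᵀ *ᵥ u) ⬝ᵥ P *ᵥ (Hᵀ *ᵥ u) := by
  rw [← mulVec_mulVec, ← mulVec_mulVec, dotProduct_mulVec_transpose]

lemma dotProduct_self_nonneg_real (u : n → ℝ) : 0 ≤ u ⬝ᵥ u :=
  Finset.sum_nonneg fun _ _ => mul_self_nonneg _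

/-- Young's inequality for a positive semidefinite form. -/
lemma two_form_le {M : Matrix n n ℝ} (hM : M.PosSemidef) (u v : n → ℝ) :
    2 * (u ⬝ᵥ M *ᵥ v) ≤ u ⬝ᵥ M *ᵥ u + v ⬝ᵥ M *ᵥ v := by
  have h := form_nonneg hM (u - v)
  have := form_comm (isSymm_of_posSemidef hM) u v
  simp only [mulVec_sub, dotProduct_sub, sub_dotProduct] at h
  linarith

/-- Fenchel's inequality for a positive definite form and its inverse. -/
lemma two_dotProduct_le [DecidableEq n] {P : Matrix n n ℝ} (hP : P.PosDef) {c : ℝ} (hc : 0 < c)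
    (z e : n → ℝ) : 2 * (z ⬝ᵥ e) ≤ c * (z ⬝ᵥ P *ᵥ z) + c⁻¹ * (e ⬝ᵥ P⁻¹ *ᵥ e) := by
  have hdet : IsUnit P.det := (Matrix.isUnit_iff_isUnit_det _).1 hP.isUnit
  -- Young's inequality in the form of `P`, at `c z` and `P⁻¹ e`; division by `c` follows.
  have h := two_form_le hP.posSemidef (c • z) (P⁻¹ *ᵥ e)
  have hPe : P *ᵥ (P⁻¹ *ᵥ e) = e := by
    rw [mulVec_mulVec, Matrix.mul_nonsing_inv _ hdet, one_mulVec]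
  rw [hPe, mulVec_smul, smul_dotProduct, smul_dotProduct, dotProduct_smul,
    dotProduct_comm (P⁻¹ *ᵥ e)] at h
  simp only [smul_eq_mul] at h
  have h' := mul_le_mul_of_nonneg_left h (inv_nonneg.2 hc.le)
  have e1 : c⁻¹ * (2 * (c * (z ⬝ᵥ e))) = 2 * (z ⬝ᵥ e) := by field_simp
  have e2 : c⁻¹ * (c * (c * (z ⬝ᵥ P *ᵥ z)) + e ⬝ᵥ P⁻¹ *ᵥ e)
      = c * (z ⬝ᵥ P *ᵥ z) + c⁻¹ * (e ⬝ᵥ P⁻¹ *ᵥ e) := by field_simp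
  rwa [e1, e2] at h'

lemma two_dotProduct_le_self {c : ℝ} (hc : 0 < c) (z e : n → ℝ) :
    2 * (z ⬝ᵥ e) ≤ c * (z ⬝ᵥ z) + c⁻¹ * (e ⬝ᵥ e) := by
  classical
  simpa using two_dotProduct_le (P := (1 : Matrix n n ℝ)) PosDef.one hc z e

/-- A quadratic form is bounded above by a multiple of the squared norm. -/
lemma exists_form_le (M : Matrix n n ℝ) : ∃ c, 0 ≤ c ∧ ∀ u, u ⬝ᵥ M *ᵥ u ≤ c * (u ⬝ᵥ u) := by
  refine ⟨∑ i, ∑ j, |M i j|, by positivity, fun u => ?_⟩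
  simp only [dotProduct, mulVec, Finset.mul_sum]
  rw [← Finset.mul_sum, Finset.sum_mul]
  refine Finset.sum_le_sum fun i _ => ?_
  rw [Finset.sum_mul]
  refine Finset.sum_le_sum fun j _ => ?_
  have key : ∀ k, u k * u k ≤ ∑ l, u l * u l := fun k =>
    Finset.single_le_sum (f := fun l => u l * u l) (fun _ _ => mul_self_nonneg _)
      (Finset.mem_univ k)
  have h1 := key i
  have h2 := key j
  have h3 : |u i| * |u j| ≤ ∑ l, u l * u l := by
    nlinarith [sq_nonneg (|u i| - |u j|), abs_mul_abs_self (u i), abs_mul_abs_self (u j)]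
  calc u i * (M i j * u j) ≤ |u i * (M i j * u j)| := le_abs_self _
    _ = |M i j| * (|u i| * |u j|) := by rw [abs_mul, abs_mul]; ring
    _ ≤ _ := mul_le_mul_of_nonneg_left h3 (abs_nonneg _)

lemma exists_norm_mulVec_le (M : Matrix m n ℝ) :
    ∃ c, 0 ≤ c ∧ ∀ u, (M *ᵥ u) ⬝ᵥ (M *ᵥ u) ≤ c * (u ⬝ᵥ u) := by
  obtain ⟨c, hc, h⟩ := exists_form_le (Mᵀ * M)
  refine ⟨c, hc, fun u => ?_⟩
  have := h u
  rwa [← mulVec_mulVec, dotProduct_mulVec_transpose, transpose_transpose] at this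

lemma add_dotProduct_self_le (u v : n → ℝ) :
    (u + v) ⬝ᵥ (u + v) ≤ 2 * (u ⬝ᵥ u) + 2 * (v ⬝ᵥ v) := by
  have h := dotProduct_self_nonneg_real (u - v)
  simp only [sub_dotProduct, dotProduct_sub, add_dotProduct, dotProduct_add] at *
  linarith

variable [DecidableEq n] [DecidableEq m]

/-- The quadratic form of `P⁻¹` at `e` controls `e`, if `P` is bounded above. -/
lemma dotProduct_self_le_of_inv {P : Matrix n n ℝ} (hP : P.PosDef) {c : ℝ} (hc : 0 < c)
    (h : ∀ u, u ⬝ᵥ P *ᵥ u ≤ c * (u ⬝ᵥ u)) (e : n → ℝ) :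
    e ⬝ᵥ e ≤ c * (e ⬝ᵥ P⁻¹ *ᵥ e) := by
  -- With weight `c⁻¹` the term `c⁻¹ eᵀPe` is at most `‖e‖²`, and is absorbed on the left.
  have h1 := two_dotProduct_le hP (inv_pos.2 hc) e e
  have h2 := mul_le_mul_of_nonneg_left (h e) (inv_nonneg.2 hc.le)
  rw [inv_inv] at h1
  rw [inv_mul_cancel_left₀ hc.ne'] at h2
  linarith

/-- Completion of squares in the gain of a linear estimator: here `Pi` is the prior covariance,
`R` the covariance of the measurement noise, and `K` the Kalman gain. -/
lemma kalman_completion {p : Type*} (H : Matrix p n ℝ) (L : Matrix p m ℝ) (C : Matrix m n ℝ)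
    {Pi : Matrix n n ℝ} {R : Matrix m m ℝ} (hPi : Pi.IsSymm) (hR : R.IsSymm)
    (hS : IsUnit (C * Pi * Cᵀ + R)) {K : Matrix n m ℝ} (hK : K = Pi * Cᵀ * (C * Pi * Cᵀ + R)⁻¹) :
    (H - L * C) * Pi * (H - L * C)ᵀ + L * R * Lᵀ =
      H * ((1 - K * C) * Pi) * Hᵀ +
        (L - H * K) * (C * Pi * Cᵀ + R) * (L - H * K)ᵀ := by
  have hKS : K * (C * Pi * Cᵀ + R) = Pi * Cᵀ := by
    rw [hK, Matrix.mul_assoc, Matrix.nonsing_inv_mul _ ((Matrix.isUnit_iff_isUnit_det _).1 hS),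
      Matrix.mul_one]
  have hSs : (C * Pi * Cᵀ + R)ᵀ = C * Pi * Cᵀ + R := by
    simp [Matrix.transpose_mul, hPi.eq, hR.eq, Matrix.mul_assoc]
  have hSK : (C * Pi * Cᵀ + R) * Kᵀ = C * Pi := by
    have := congrArg Matrix.transpose hKS
    simpa [Matrix.transpose_mul, hPi.eq, hR.eq, Matrix.mul_assoc] using this
  set S := C * Pi * Cᵀ + R with hSdef
  have hR' : R = S - C * Pi * Cᵀ := by rw [hSdef]; abel
  -- The square is expanded with `S` next to `K`, so that `hKS` and `hSK` remove the inverse and a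
  -- polynomial identity remains.
  have e1 : (L - H * K) * S * (L - H * K)ᵀ
      = L * S * Lᵀ - L * (S * Kᵀ) * Hᵀ - H * (K * S) * Lᵀ + H * (K * (S * Kᵀ)) * Hᵀ := by
    simp only [Matrix.transpose_sub, Matrix.transpose_mul, Matrix.sub_mul, Matrix.mul_sub,
      Matrix.mul_assoc]
    abel
  rw [e1, hSK, hKS, hR']
  simp only [Matrix.transpose_sub, Matrix.transpose_mul, Matrix.sub_mul, Matrix.mul_sub,
      Matrix.mul_assoc, Matrix.one_mul]
  abel

end LinearAlgebra

/-! ### A Lyapunov function from Schur stability -/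

section Stability

variable {n : ℕ}

attribute [local instance] Matrix.frobeniusNormedRing Matrix.frobeniusNormedAlgebra

/-- By Gelfand's formula `‖F ^ k‖ ^ (1 / k)` tends to the spectral radius, which is below one, so
the norms are eventually dominated by a geometric sequence. The Frobenius norm is submultiplicative
and its square is the sum of squared entries. -/
lemma summable_frobenius_pow (F : Mat n)
    (hF : ∀ z ∈ spectrum ℂ (F.map (algebraMap ℝ ℂ)), ‖z‖ < 1) :
    Summable fun k : ℕ => ∑ i, ∑ j, (F ^ k) i j ^ 2 := by
  rcases Nat.eq_zero_or_pos n with rfl | hn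
  · simp
  have : NeZero n := ⟨hn.ne'⟩
  set G : Matrix (Fin n) (Fin n) ℂ := F.map (algebraMap ℝ ℂ) with hG
  have : CompleteSpace (Matrix (Fin n) (Fin n) ℂ) := FiniteDimensional.complete ℂ _
  have hr : spectralRadius ℂ G < ((1 : NNReal) : ENNReal) :=
    spectrum.spectralRadius_lt_of_forall_lt G fun z hz => by
      simpa [← NNReal.coe_lt_coe] using hF z hz
  obtain ⟨r, hr1, hr2⟩ := ENNReal.lt_iff_exists_nnreal_btwn.1 hr
  have hr2' : r < 1 := by exact_mod_cast hr2
  have hev :=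
    (spectrum.pow_nnnorm_pow_one_div_tendsto_nhds_spectralRadius G).eventually_lt_const hr1
  have hnorm : ∀ k : ℕ, ∑ i, ∑ j, (F ^ k) i j ^ 2 = ‖G ^ k‖ ^ 2 := by
    intro k
    have hGk : G ^ k = (F ^ k).map (algebraMap ℝ ℂ) := by
      exact (map_pow (algebraMap ℝ ℂ).mapMatrix F k).symm
    rw [hGk, Matrix.frobenius_norm_def, ← Real.sqrt_eq_rpow, Real.sq_sqrt (by positivity)]
    refine Finset.sum_congr rfl fun i _ => Finset.sum_congr rfl fun j _ => ?_
    simp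
  have hgeo : Summable fun k : ℕ => ((r : ℝ) ^ 2) ^ k :=
    summable_geometric_of_lt_one (by positivity) (by
      have : (r : ℝ) < 1 := by exact_mod_cast hr2'
      nlinarith [r.coe_nonneg])
  refine Summable.of_norm_bounded_eventually_nat hgeo ?_
  filter_upwards [hev, Filter.eventually_ge_atTop 1] with k hk hk1
  have h1 : (‖G ^ k‖₊ : ENNReal) ≤ (r : ENNReal) ^ k := by
    have h2 := ENNReal.rpow_le_rpow hk.le (z := k) (by positivity)
    have hk0 : (k : ℝ) ≠ 0 := by positivity
    rwa [← ENNReal.rpow_mul, one_div, inv_mul_cancel₀ hk0, ENNReal.rpow_one,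
      ENNReal.rpow_natCast] at h2
  have h2 : ‖G ^ k‖ ≤ (r : ℝ) ^ k := by exact_mod_cast h1
  rw [hnorm, Real.norm_of_nonneg (by positivity), ← pow_mul, mul_comm 2 k, pow_mul]
  gcongr

lemma transpose_mulVec_dotProduct_le (M : Mat n) (u : Vec n) :
    (Mᵀ *ᵥ u) ⬝ᵥ (Mᵀ *ᵥ u) ≤ (∑ i, ∑ j, M i j ^ 2) * (u ⬝ᵥ u) := by
  rw [Finset.sum_comm, Finset.sum_mul]
  simp only [dotProduct, mulVec, transpose_apply]
  refine Finset.sum_le_sum fun j _ => ?_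
  have := Finset.sum_mul_sq_le_sq_mul_sq Finset.univ (fun i => M i j) u
  simpa [sq] using this

/-- A quadratic Lyapunov function for the transpose of a Schur stable matrix. -/
lemma exists_lyapunov (F : Mat n)
    (hF : ∀ z ∈ spectrum ℂ (F.map (algebraMap ℝ ℂ)), ‖z‖ < 1) :
    ∃ θ : Vec n → ℝ, ∃ p : ℝ, 0 ≤ p ∧ ∀ u, 0 ≤ θ u ∧ u ⬝ᵥ u + θ (Fᵀ *ᵥ u) ≤ θ u ∧
      θ u ≤ p * (u ⬝ᵥ u) := by
  have hs := summable_frobenius_pow F hF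
  have hsu : ∀ u : Vec n, Summable fun k : ℕ => ((F ^ k)ᵀ *ᵥ u) ⬝ᵥ ((F ^ k)ᵀ *ᵥ u) := fun u =>
    Summable.of_nonneg_of_le (fun _ => dotProduct_self_nonneg_real _)
      (fun k => transpose_mulVec_dotProduct_le _ u) (hs.mul_right _)
  -- The energy of the whole trajectory of `Fᵀ` from `u`: one step of `Fᵀ` removes exactly the first
  -- term `u ⬝ᵥ u`.
  refine ⟨fun u => ∑' k : ℕ, ((F ^ k)ᵀ *ᵥ u) ⬝ᵥ ((F ^ k)ᵀ *ᵥ u),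
    ∑' k : ℕ, ∑ i, ∑ j, (F ^ k) i j ^ 2, tsum_nonneg fun _ => by positivity,
    fun u => ⟨tsum_nonneg fun _ => dotProduct_self_nonneg_real _, le_of_eq ?_, ?_⟩⟩
  · beta_reduce
    rw [(hsu u).tsum_eq_zero_add]
    congr 1
    · simp
    · refine tsum_congr fun k => ?_
      rw [pow_succ', Matrix.transpose_mul, ← mulVec_mulVec]
  · beta_reduce
    rw [← tsum_mul_right]
    exact (hsu u).tsum_le_tsum (fun k => transpose_mulVec_dotProduct_le _ u) (hs.mul_right _)

end Stability

/-! ### The Kalman step: optimality, contraction and bounded covariances -/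

section Kalman

variable {d n m : ℕ}

/-- `G` is symmetric and `a I ≤ G ≤ b I` in the Loewner order. -/
def Between (a b : ℝ) (G : Mat d) : Prop :=
  G.IsSymm ∧ ∀ u : Vec d, a * (u ⬝ᵥ u) ≤ u ⬝ᵥ G *ᵥ u ∧ u ⬝ᵥ G *ᵥ u ≤ b * (u ⬝ᵥ u)

lemma dotProduct_self_pos_real {u : Vec d} (hu : u ≠ 0) : 0 < u ⬝ᵥ u := by
  refine lt_of_le_of_ne (dotProduct_self_nonneg_real u) fun h => hu ?_
  exact dotProduct_self_eq_zero.1 h.symm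

lemma Between.posDef {a b : ℝ} {G : Mat d} (h : Between a b G) (ha : 0 < a) : G.PosDef :=
  posDef_of_form h.1 fun u hu =>
    lt_of_lt_of_le (mul_pos ha (dotProduct_self_pos_real hu)) (h.2 u).1

/-- The Kalman gain for the prior covariance `P` and the noise covariance `R`. -/
def kalmanGain (C : Matrix (Fin m) (Fin n) ℝ) (P : Mat n) (R : Mat m) :
    Matrix (Fin n) (Fin m) ℝ :=
  P * Cᵀ * (C * P * Cᵀ + R)⁻¹

/-- The posterior covariance for the prior covariance `P` and the noise covariance `R`. -/
def kalmanCov (C : Matrix (Fin m) (Fin n) ℝ) (P : Mat n) (R : Mat m) : Mat n :=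
  (1 - kalmanGain C P R * C) * P

variable (C : Matrix (Fin m) (Fin n) ℝ) {P : Mat n} {R : Mat m}

lemma innovation_posDef (hP : P.PosDef) (hR : R.PosDef) : (C * P * Cᵀ + R).PosDef :=
  PosDef.posSemidef_add (by simpa using hP.posSemidef.mul_mul_conjTranspose_same C) hR

/-- The posterior covariance is at most the error covariance of any other gain `L`. -/
lemma kalmanCov_form_le {k : ℕ} (hP : P.PosDef) (hR : R.PosDef) (H : Matrix (Fin k) (Fin n) ℝ)
    (L : Matrix (Fin k) (Fin m) ℝ) (u : Vec k) :
    (Hᵀ *ᵥ u) ⬝ᵥ kalmanCov C P R *ᵥ (Hᵀ *ᵥ u) ≤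
      ((H - L * C)ᵀ *ᵥ u) ⬝ᵥ P *ᵥ ((H - L * C)ᵀ *ᵥ u) + (Lᵀ *ᵥ u) ⬝ᵥ R *ᵥ (Lᵀ *ᵥ u) := by
  have hS := innovation_posDef C hP hR
  have h := kalman_completion H L C (isSymm_of_posDef hP) (isSymm_of_posDef hR) hS.isUnit
    (K := kalmanGain C P R) rfl
  rw [← form_conj, ← form_conj, ← form_conj, ← dotProduct_add, ← add_mulVec, h, add_mulVec,
    dotProduct_add]
  have h0 : 0 ≤ u ⬝ᵥ ((L - H * kalmanGain C P R) * (C * P * Cᵀ + R) *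
      (L - H * kalmanGain C P R)ᵀ) *ᵥ u := by
    rw [form_conj]; exact form_nonneg hS.posSemidef _
  exact le_add_of_nonneg_right h0

lemma kalmanCov_form_le_prior (hP : P.PosDef) (hR : R.PosDef) (u : Vec n) :
    u ⬝ᵥ kalmanCov C P R *ᵥ u ≤ u ⬝ᵥ P *ᵥ u := by
  simpa using kalmanCov_form_le C hP hR 1 0 u

/-- Joseph's form of the posterior covariance. -/
lemma kalmanCov_eq (hP : P.PosDef) (hR : R.PosDef) :
    kalmanCov C P R = (1 - kalmanGain C P R * C) * P * (1 - kalmanGain C P R * C)ᵀ +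
      kalmanGain C P R * R * (kalmanGain C P R)ᵀ := by
  have h := kalman_completion 1 (kalmanGain C P R) C (isSymm_of_posDef hP) (isSymm_of_posDef hR)
    (innovation_posDef C hP hR).isUnit (K := kalmanGain C P R) rfl
  simpa [kalmanCov] using h.symm

lemma kalmanCov_form (hP : P.PosDef) (hR : R.PosDef) (z : Vec n) :
    z ⬝ᵥ kalmanCov C P R *ᵥ z =
      ((1 - kalmanGain C P R * C)ᵀ *ᵥ z) ⬝ᵥ P *ᵥ ((1 - kalmanGain C P R * C)ᵀ *ᵥ z) +
        ((kalmanGain C P R)ᵀ *ᵥ z) ⬝ᵥ R *ᵥ ((kalmanGain C P R)ᵀ *ᵥ z) := by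
  rw [← form_conj, ← form_conj, ← dotProduct_add, ← add_mulVec, ← kalmanCov_eq C hP hR]

lemma kalmanCov_posDef (hP : P.PosDef) (hR : R.PosDef) : (kalmanCov C P R).PosDef := by
  refine posDef_of_form ?_ fun z hz => ?_
  · have h1 := isSymm_of_posDef hP
    have h2 := isSymm_of_posDef hR
    rw [kalmanCov_eq C hP hR]
    refine Matrix.IsSymm.add ?_ ?_ <;>
      simp only [Matrix.IsSymm, Matrix.transpose_mul, Matrix.transpose_transpose, h1.eq, h2.eq,
        Matrix.mul_assoc]
  · rw [kalmanCov_form C hP hR]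
    -- In Joseph's form, either the noise term is positive, or the gain does not see `z` and the
    -- prior term is that of `z` itself.
    by_cases h : (kalmanGain C P R)ᵀ *ᵥ z = 0
    · have h1 : (1 - kalmanGain C P R * C)ᵀ *ᵥ z = z := by
        rw [Matrix.transpose_sub, Matrix.transpose_mul, sub_mulVec, ← mulVec_mulVec, h]
        simp
      rw [h1, h]
      simpa using form_pos hP hz
    · exact add_pos_of_nonneg_of_pos (form_nonneg hP.posSemidef _) (form_pos hR h)

variable (A : Mat n) {Q : Mat n} {a b β β' : ℝ}

lemma predCov_posDef (hP : P.PosDef) (hQ : Q.PosDef) : (A * P * Aᵀ + Q).PosDef :=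
  PosDef.posSemidef_add (by simpa using hP.posSemidef.mul_mul_conjTranspose_same A) hQ

lemma predCov_form (u : Vec n) : u ⬝ᵥ (A * P * Aᵀ + Q) *ᵥ u =
    (Aᵀ *ᵥ u) ⬝ᵥ P *ᵥ (Aᵀ *ᵥ u) + u ⬝ᵥ Q *ᵥ u := by
  rw [add_mulVec, dotProduct_add, form_conj]

/-- One step of the Kalman filter contracts the error, measured by the inverse covariance, up to
the noise; this holds for arbitrary noises `w`, `v`. -/
lemma kalman_contraction (hP : P.PosDef) (hQ : Between a b Q) (ha : 0 < a)
    (hR : Between β β' R) (hβ : 0 < β) {δ : ℝ} (hδ : 0 < δ)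
    (hA : ∀ u : Vec n, δ * ((Aᵀ *ᵥ u) ⬝ᵥ P *ᵥ (Aᵀ *ᵥ u)) ≤ a / 2 * (u ⬝ᵥ u))
    (e w : Vec n) (v : Vec m) {e' : Vec n}
    (he' : e' = (1 - kalmanGain C (A * P * Aᵀ + Q) R * C) *ᵥ (A *ᵥ e + w) -
      kalmanGain C (A * P * Aᵀ + Q) R *ᵥ v) :
    e' ⬝ᵥ (kalmanCov C (A * P * Aᵀ + Q) R)⁻¹ *ᵥ e' ≤
      (1 + δ)⁻¹ * (e ⬝ᵥ P⁻¹ *ᵥ e) + (2 / a * (w ⬝ᵥ w) + β⁻¹ * (v ⬝ᵥ v)) := by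
  have hQ' := hQ.posDef ha
  have hR' := hR.posDef hβ
  have hPt := predCov_posDef A hP hQ'
  have hN := kalmanCov_posDef C hPt hR'
  -- Dual vector: with `N` the posterior covariance, the left side equals `2 zᵀe' - zᵀNz`. Joseph's
  -- form splits `zᵀNz` into terms that compensate the pairings of `z` with `e`, `w` and `v`.
  set z := (kalmanCov C (A * P * Aᵀ + Q) R)⁻¹ *ᵥ e' with hz
  have hNz : kalmanCov C (A * P * Aᵀ + Q) R *ᵥ z = e' := by
    rw [hz, mulVec_mulVec, Matrix.mul_nonsing_inv _ ((Matrix.isUnit_iff_isUnit_det _).1 hN.isUnit),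
      one_mulVec]
  have hform := kalmanCov_form C hPt hR' z
  rw [hNz, predCov_form] at hform
  have hdot : z ⬝ᵥ e' = ((1 - kalmanGain C (A * P * Aᵀ + Q) R * C)ᵀ *ᵥ z) ⬝ᵥ (A *ᵥ e + w) -
      ((kalmanGain C (A * P * Aᵀ + Q) R)ᵀ *ᵥ z) ⬝ᵥ v := by
    rw [he', dotProduct_sub, dotProduct_mulVec_transpose, dotProduct_mulVec_transpose]
  rw [dotProduct_comm e' z]
  set z₁ := (1 - kalmanGain C (A * P * Aᵀ + Q) R * C)ᵀ *ᵥ z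
  set z₂ := (kalmanGain C (A * P * Aᵀ + Q) R)ᵀ *ᵥ z
  rw [dotProduct_add, dotProduct_mulVec_transpose] at hdot
  -- The lower bound `a` of `Q` is shared: one half pays for the excess `δ` that makes the factor
  -- `(1 + δ)⁻¹`, the other half absorbs `w`.
  have h1 := two_dotProduct_le hP (c := 1 + δ) (by positivity) (Aᵀ *ᵥ z₁) e
  have h2 := two_dotProduct_le_self (c := a / 2) (by positivity) z₁ w
  have h3 := two_dotProduct_le_self hβ z₂ (-v)
  have h4 := (hQ.2 z₁).1
  have h5 := (hR.2 z₂).1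
  have h6 := hA z₁
  rw [inv_div] at h2
  rw [dotProduct_neg, neg_dotProduct_neg] at h3
  linarith

/-- The bound that is propagated along the Riccati recursion. -/
def CovBound (A : Mat n) (b : ℝ) (θ : Vec n → ℝ) (P : Mat n) : Prop :=
  ∀ u : Vec n, (Aᵀ *ᵥ u) ⬝ᵥ P *ᵥ (Aᵀ *ᵥ u) + b * (u ⬝ᵥ u) ≤ θ u

/-- The Kalman gain is compared with the fixed gain `L`, the forms being taken at `Aᵀ u`. The
comparison filter moves `u` to `(A - L * C)ᵀ u`, where the old bound applies, and the Lyapunov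
inequality pays for the two noise terms. Stating the bound with `b` in place of `Q` makes it
independent of the current estimate. -/
lemma CovBound.step {θ : Vec n → ℝ} (hP : P.PosDef) (hQ : Between a b Q) (ha : 0 < a)
    (hR : Between β β' R) (hβ : 0 < β) (L : Matrix (Fin n) (Fin m) ℝ)
    (hθ : ∀ u : Vec n, β' * ((Lᵀ *ᵥ u) ⬝ᵥ (Lᵀ *ᵥ u)) + b * (u ⬝ᵥ u) +
      θ ((A - L * C)ᵀ *ᵥ u) ≤ θ u)
    (h : CovBound A b θ P) : CovBound A b θ (kalmanCov C (A * P * Aᵀ + Q) R) := by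
  intro u
  have h1 := kalmanCov_form_le C (predCov_posDef A hP (hQ.posDef ha)) (hR.posDef hβ) A L u
  have h2 := predCov_form A (P := P) (Q := Q) ((A - L * C)ᵀ *ᵥ u)
  have h3 := h ((A - L * C)ᵀ *ᵥ u)
  have h4 := (hQ.2 ((A - L * C)ᵀ *ᵥ u)).2
  have h5 := (hR.2 (Lᵀ *ᵥ u)).2
  have h6 := hθ u
  linarith

/-- A measurement cannot increase the covariance, and `CovBound` controls the predicted one. -/
lemma CovBound.form_le {θ : Vec n → ℝ} (hP : P.PosDef) (hQ : Between a b Q) (ha : 0 < a)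
    (hR : Between β β' R) (hβ : 0 < β) (h : CovBound A b θ P) (u : Vec n) :
    u ⬝ᵥ kalmanCov C (A * P * Aᵀ + Q) R *ᵥ u ≤ θ u := by
  have h1 := kalmanCov_form_le_prior C (predCov_posDef A hP (hQ.posDef ha)) (hR.posDef hβ) u
  have h2 := predCov_form A (P := P) (Q := Q) u
  have h3 := h u
  have h4 := (hQ.2 u).2
  linarith

/-- For a detectable pair there is a bound that is preserved by the Riccati recursion. -/
lemma exists_covBound (P₀ : Mat n) (hb : 0 ≤ b) (hβ' : 0 ≤ β')
    (hdet : Detectable A C) :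
    ∃ (L : Matrix (Fin n) (Fin m) ℝ) (θ : Vec n → ℝ) (p : ℝ), 0 < p ∧ CovBound A b θ P₀ ∧
      (∀ u : Vec n, u ⬝ᵥ P₀ *ᵥ u ≤ p * (u ⬝ᵥ u)) ∧
      (∀ u : Vec n, θ u ≤ p * (u ⬝ᵥ u)) ∧
      ∀ u : Vec n, β' * ((Lᵀ *ᵥ u) ⬝ᵥ (Lᵀ *ᵥ u)) + b * (u ⬝ᵥ u) +
        θ ((A - L * C)ᵀ *ᵥ u) ≤ θ u := by
  obtain ⟨L, hL⟩ := hdet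
  obtain ⟨θ, p, hp, hθ⟩ := exists_lyapunov _ hL
  obtain ⟨l, hl0, hl⟩ := exists_norm_mulVec_le Lᵀ
  obtain ⟨q, hq0, hq⟩ := exists_form_le P₀
  obtain ⟨r, hr0, hr⟩ := exists_form_le (A * P₀ * Aᵀ)
  -- Scaling the Lyapunov function by `c` pays for the measurement noise through `L` (`β' * l`), the
  -- process noise (`b`) and the initial predicted covariance (`r`).
  set c := β' * l + b + r with hc
  have hc0 : 0 ≤ c := by positivity
  refine ⟨L, fun u => c * θ u, c * p + q + 1, by positivity, fun u => ?_, fun u => ?_, fun u => ?_,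
    fun u => ?_⟩
  · have h1 := hr u
    rw [form_conj] at h1
    have h2 : u ⬝ᵥ u ≤ θ u := by linarith [(hθ u).2.1, (hθ ((A - L * C)ᵀ *ᵥ u)).1]
    have h3 := mul_le_mul_of_nonneg_left h2 hc0
    have h4 : 0 ≤ β' * l * (u ⬝ᵥ u) :=
      mul_nonneg (by positivity) (dotProduct_self_nonneg_real u)
    rw [hc] at h3 ⊢
    linarith
  · have := hq u
    have h4 : 0 ≤ (c * p + 1) * (u ⬝ᵥ u) :=
      mul_nonneg (by positivity) (dotProduct_self_nonneg_real u)
    linarith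
  · have := mul_le_mul_of_nonneg_left (hθ u).2.2 hc0
    have h4 : 0 ≤ (q + 1) * (u ⬝ᵥ u) :=
      mul_nonneg (by positivity) (dotProduct_self_nonneg_real u)
    linarith
  · have h1 := mul_le_mul_of_nonneg_left (hθ u).2.1 hc0
    have h2 := mul_le_mul_of_nonneg_left (hl u) hβ'
    have h4 : 0 ≤ r * (u ⬝ᵥ u) := mul_nonneg (by positivity) (dotProduct_self_nonneg_real u)
    have h5 : c * (u ⬝ᵥ u) = β' * (l * (u ⬝ᵥ u)) + b * (u ⬝ᵥ u) + r * (u ⬝ᵥ u) := by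
      rw [hc]; ring
    linarith

end Kalman

/-! ### The least-squares problem over the window -/

section Window

lemma sum_ite_succ {T : ℕ} (f : Fin (T + 1) → Fin (T + 1) → ℝ) :
    ∑ a : Fin (T + 1), ∑ b : Fin (T + 1), (if (a : ℕ) = b + 1 then f a b else 0) =
      ∑ i : Fin T, f i.succ i.castSucc := by
  rw [Fin.sum_univ_succ]
  have h0 : ∑ b : Fin (T + 1), (if ((0 : Fin (T + 1)) : ℕ) = b + 1 then f 0 b else 0) = 0 :=
    Finset.sum_eq_zero fun b _ => by simp
  rw [h0, zero_add]
  refine Finset.sum_congr rfl fun i _ => ?_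
  rw [Finset.sum_eq_single i.castSucc]
  · simp
  · intro b _ hb
    rw [if_neg]
    intro h
    apply hb
    ext
    simp only [Fin.val_succ, Fin.val_castSucc] at h ⊢
    omega
  · simp

lemma dotProduct_winMulVec {T d : ℕ} (M : WinMat T d) (u z : WinVec T d) :
    u ⬝ᵥ M *ᵥ z = ∑ a, ∑ b, u.block a ⬝ᵥ M.block a b *ᵥ z.block b := by
  simp only [dotProduct, mulVec, WinVec.block, WinMat.block, Fintype.sum_prod_type, Matrix.of_apply]
  refine Finset.sum_congr rfl fun a _ => ?_
  rw [Finset.sum_comm]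
  refine Finset.sum_congr rfl fun i _ => ?_
  rw [Finset.mul_sum]

lemma WinVec.block_sub {T d : ℕ} (u z : WinVec T d) (a : Fin (T + 1)) :
    WinVec.block (u - z) a = u.block a - z.block a := rfl

lemma WinVec.eq_zero_of_block {T d : ℕ} {u : WinVec T d} (h : ∀ a, u.block a = 0) : u = 0 := by
  ext ⟨a, i⟩
  exact congrFun (h a) i

namespace VBFilter

variable {Ω : Type*} {nx ny : ℕ} (F : VBFilter Ω nx ny)

/-- The three bands are disjoint, so the nested conditional is a sum, which double sums can be
distributed over. -/
lemma precisionBlock_eq (P Φ : Mat nx) (Ψ : Mat ny) (a b : Fin (F.T + 1)) :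
    F.precisionBlock P Φ Ψ a b =
      (if a = b then (if (a : ℕ) = 0 then P⁻¹ else F.Cᵀ * Ψ * F.C + Φ) +
        (if (a : ℕ) < F.T then F.Aᵀ * Φ * F.A else 0) else 0) +
      (if (a : ℕ) = b + 1 then -(Φ * F.A) else 0) +
      (if (b : ℕ) = a + 1 then -(F.Aᵀ * Φ) else 0) := by
  unfold precisionBlock
  by_cases h : a = b
  · subst h; simp
  · by_cases h1 : (a : ℕ) = b + 1
    · have h2 : ¬ (b : ℕ) = a + 1 := by omega
      rw [if_neg h, if_neg h, if_pos h1, if_pos h1, if_neg h2, zero_add, add_zero]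
    · simp [h, h1]

/-- The bilinear form of the precision matrix of the window. -/
lemma precision_form (P Φ : Mat nx) (Ψ : Mat ny) (u z : WinVec F.T nx) :
    u ⬝ᵥ F.precision P Φ Ψ *ᵥ z = u.block 0 ⬝ᵥ P⁻¹ *ᵥ z.block 0 +
      ∑ i : Fin F.T, ((u.block i.succ - F.A *ᵥ u.block i.castSucc) ⬝ᵥ
          Φ *ᵥ (z.block i.succ - F.A *ᵥ z.block i.castSucc) +
        (F.C *ᵥ u.block i.succ) ⬝ᵥ Ψ *ᵥ (F.C *ᵥ z.block i.succ)) := by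
  have hblock : ∀ a b, (F.precision P Φ Ψ).block a b = F.precisionBlock P Φ Ψ a b :=
    fun a b => rfl
  rw [dotProduct_winMulVec]
  simp only [hblock, precisionBlock_eq, add_mulVec, dotProduct_add, Finset.sum_add_distrib]
  have hsub : ∑ a, ∑ b, u.block a ⬝ᵥ
      (if (a : ℕ) = (b : Fin (F.T + 1)) + 1 then -(Φ * F.A) else 0) *ᵥ z.block b =
      ∑ i : Fin F.T, u.block i.succ ⬝ᵥ (-(Φ * F.A)) *ᵥ z.block i.castSucc := by
    rw [← sum_ite_succ fun a b => u.block a ⬝ᵥ (-(Φ * F.A)) *ᵥ z.block b]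
    refine Finset.sum_congr rfl fun a _ => Finset.sum_congr rfl fun b _ => ?_
    split_ifs <;> simp
  have hsup : ∑ a, ∑ b, u.block a ⬝ᵥ
      (if ((b : Fin (F.T + 1)) : ℕ) = (a : Fin (F.T + 1)) + 1 then -(F.Aᵀ * Φ) else 0) *ᵥ
        z.block b =
      ∑ i : Fin F.T, u.block i.castSucc ⬝ᵥ (-(F.Aᵀ * Φ)) *ᵥ z.block i.succ := by
    rw [Finset.sum_comm, ← sum_ite_succ fun b a => u.block a ⬝ᵥ (-(F.Aᵀ * Φ)) *ᵥ z.block b]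
    refine Finset.sum_congr rfl fun a _ => Finset.sum_congr rfl fun b _ => ?_
    split_ifs <;> simp
  have hdiag : ∑ a, ∑ b, u.block a ⬝ᵥ
      (if a = b then (if (a : ℕ) = 0 then P⁻¹ else F.Cᵀ * Ψ * F.C + Φ) +
        (if (a : ℕ) < F.T then F.Aᵀ * Φ * F.A else 0) else 0) *ᵥ z.block b =
      u.block 0 ⬝ᵥ P⁻¹ *ᵥ z.block 0 +
        ∑ i : Fin F.T, u.block i.succ ⬝ᵥ (F.Cᵀ * Ψ * F.C + Φ) *ᵥ z.block i.succ +
        ∑ i : Fin F.T, u.block i.castSucc ⬝ᵥ (F.Aᵀ * Φ * F.A) *ᵥ z.block i.castSucc := by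
    have h1 : ∀ a : Fin (F.T + 1), ∑ b, u.block a ⬝ᵥ
        (if a = b then (if (a : ℕ) = 0 then P⁻¹ else F.Cᵀ * Ψ * F.C + Φ) +
        (if (a : ℕ) < F.T then F.Aᵀ * Φ * F.A else 0) else 0) *ᵥ z.block b =
        u.block a ⬝ᵥ (if (a : ℕ) = 0 then P⁻¹ else F.Cᵀ * Ψ * F.C + Φ) *ᵥ z.block a +
        u.block a ⬝ᵥ (if (a : ℕ) < F.T then F.Aᵀ * Φ * F.A else 0) *ᵥ z.block a := by
      intro a
      rw [Finset.sum_eq_single a, if_pos rfl, add_mulVec, dotProduct_add]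
      · intro b _ hb
        rw [if_neg (Ne.symm hb)]
        simp
      · simp
    -- The first sum is split at block `0`, which carries `P⁻¹`; the second is split at the last
    -- block, which has no outgoing transition.
    rw [Finset.sum_congr rfl fun a _ => h1 a, Finset.sum_add_distrib, Fin.sum_univ_succ]
    congr 1
    rw [Fin.sum_univ_castSucc]
    simp
  rw [hdiag, hsub, hsup]
  simp only [← Finset.sum_add_distrib, add_assoc]
  congr 1
  refine Finset.sum_congr rfl fun i _ => ?_
  simp only [add_mulVec, dotProduct_add, neg_mulVec, dotProduct_neg, ← mulVec_mulVec,
    mulVec_sub, dotProduct_sub, sub_dotProduct]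
  rw [dotProduct_mulVec_transpose F.Cᵀ, dotProduct_mulVec_transpose F.Aᵀ,
    dotProduct_mulVec_transpose F.Aᵀ, transpose_transpose, transpose_transpose]
  ring

lemma dotProduct_infoVec (y : ℕ → Vec ny) (t : ℕ) (st : State nx ny) (Ψ : Mat ny)
    (u : WinVec F.T nx) :
    u ⬝ᵥ F.infoVec y t st Ψ = u.block 0 ⬝ᵥ st.P⁻¹ *ᵥ st.x +
      ∑ i : Fin F.T, (F.C *ᵥ u.block i.succ) ⬝ᵥ Ψ *ᵥ y (t - F.T + (i + 1)) := by
  have h : u ⬝ᵥ F.infoVec y t st Ψ = ∑ a : Fin (F.T + 1), u.block a ⬝ᵥ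
      (if (a : ℕ) = 0 then st.P⁻¹ *ᵥ st.x else (F.Cᵀ * Ψ) *ᵥ y (t - F.T + a)) := by
    simp only [dotProduct, WinVec.block, Fintype.sum_prod_type, infoVec]
  rw [h, Fin.sum_univ_succ]
  congr 1
  refine Finset.sum_congr rfl fun i _ => ?_
  rw [if_neg (by simp), ← mulVec_mulVec, dotProduct_mulVec_transpose F.Cᵀ, transpose_transpose]
  simp

variable {P Φ : Mat nx} {Ψ : Mat ny}

/-- Zero energy forces block `0` to vanish and then, transition by transition, all later blocks.
Symmetry is read off the bilinear form. -/
lemma precision_posDef (hP : P.PosDef) (hΦ : Φ.PosDef) (hΨ : Ψ.PosDef) :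
    (F.precision P Φ Ψ).PosDef := by
  have hsymm : ∀ u z, u ⬝ᵥ F.precision P Φ Ψ *ᵥ z = z ⬝ᵥ F.precision P Φ Ψ *ᵥ u := by
    intro u z
    rw [precision_form, precision_form]
    rw [form_comm (isSymm_of_posDef hP.inv)]
    congr 1
    refine Finset.sum_congr rfl fun i _ => ?_
    rw [form_comm (isSymm_of_posDef hΦ), form_comm (isSymm_of_posDef hΨ)]
  refine posDef_of_form ?_ fun (u : WinVec F.T nx) hu => ?_
  · ext p q
    have := hsymm (Pi.single q 1) (Pi.single p 1)
    simpa using this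
  · have h0 := form_nonneg hP.inv.posSemidef (u.block 0)
    have h1 : ∀ i ∈ Finset.univ, 0 ≤ (u.block (Fin.succ i) - F.A *ᵥ u.block i.castSucc) ⬝ᵥ
          Φ *ᵥ (u.block i.succ - F.A *ᵥ u.block i.castSucc) +
        (F.C *ᵥ u.block i.succ) ⬝ᵥ Ψ *ᵥ (F.C *ᵥ u.block i.succ) := fun i _ =>
      add_nonneg (form_nonneg hΦ.posSemidef _) (form_nonneg hΨ.posSemidef _)
    rw [precision_form]
    refine lt_of_le_of_ne (add_nonneg h0 (Finset.sum_nonneg h1)) fun h => hu ?_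
    have h0' : u.block 0 ⬝ᵥ P⁻¹ *ᵥ u.block 0 = 0 := by
      linarith [Finset.sum_nonneg h1]
    have h1' := (Finset.sum_eq_zero_iff_of_nonneg h1).1 (by linarith)
    have hz : u.block 0 = 0 := by
      by_contra hne
      exact (form_pos hP.inv hne).ne' h0'
    refine WinVec.eq_zero_of_block fun a => ?_
    induction a using Fin.induction with
    | zero => exact hz
    | succ i ih =>
      have hi := h1' i (Finset.mem_univ i)
      rw [ih, mulVec_zero, sub_zero] at hi
      by_contra hne
      linarith [form_pos hΦ hne, form_nonneg hΨ.posSemidef (F.C *ᵥ u.block i.succ)]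

lemma winCov_posDef {st : State nx ny} (hP : st.P.PosDef) (hΦ : Φ.PosDef) (hΨ : Ψ.PosDef) :
    (F.winCov st Φ Ψ).PosDef :=
  (F.precision_posDef hP hΦ hΨ).inv

/-- The normal equations of the window problem. -/
lemma precision_mulVec_winMean (y : ℕ → Vec ny) (t : ℕ) {st : State nx ny} (hP : st.P.PosDef)
    (hΦ : Φ.PosDef) (hΨ : Ψ.PosDef) :
    F.precision st.P Φ Ψ *ᵥ F.winMean y t st Φ Ψ = F.infoVec y t st Ψ := by
  rw [winMean, winCov, mulVec_mulVec, Matrix.mul_nonsing_inv _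
    ((Matrix.isUnit_iff_isUnit_det _).1 (F.precision_posDef hP hΦ hΨ).isUnit), one_mulVec]

/-- The energy of the estimation error over the window is at most that of the disturbances. -/
lemma winError_form_le (y : ℕ → Vec ny) (t : ℕ) {st : State nx ny} (hP : st.P.PosDef)
    (hΦ : Φ.PosDef) (hΨ : Ψ.PosDef) {X : WinVec F.T nx} {w : Fin F.T → Vec nx}
    {v : Fin F.T → Vec ny}
    (hX : ∀ i : Fin F.T, X.block i.succ = F.A *ᵥ X.block i.castSucc + w i)
    (hy : ∀ i : Fin F.T, y (t - F.T + (i + 1)) = F.C *ᵥ X.block i.succ + v i)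
    {E : WinVec F.T nx} (hE : E = X - F.winMean y t st Φ Ψ) :
    E ⬝ᵥ F.precision st.P Φ Ψ *ᵥ E ≤
      (X.block 0 - st.x) ⬝ᵥ st.P⁻¹ *ᵥ (X.block 0 - st.x) +
        ∑ i : Fin F.T, (w i ⬝ᵥ Φ *ᵥ w i + v i ⬝ᵥ Ψ *ᵥ v i) := by
  have h1 : E ⬝ᵥ F.precision st.P Φ Ψ *ᵥ E =
      E ⬝ᵥ F.precision st.P Φ Ψ *ᵥ X - E ⬝ᵥ F.infoVec y t st Ψ := by
    rw [← F.precision_mulVec_winMean y t hP hΦ hΨ, ← dotProduct_sub, ← mulVec_sub, ← hE]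
  -- The residuals of the true trajectory are exactly the prior error, `w` and `-v`. Young's
  -- inequality then leaves half of the error energy on the right, where it is absorbed.
  have h2 : E ⬝ᵥ F.precision st.P Φ Ψ *ᵥ E = E.block 0 ⬝ᵥ st.P⁻¹ *ᵥ (X.block 0 - st.x) +
      ∑ i : Fin F.T, ((E.block i.succ - F.A *ᵥ E.block i.castSucc) ⬝ᵥ Φ *ᵥ w i +
        (F.C *ᵥ E.block i.succ) ⬝ᵥ Ψ *ᵥ (-v i)) := by
    rw [h1, precision_form, dotProduct_infoVec, add_sub_add_comm, ← Finset.sum_sub_distrib,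
      ← dotProduct_sub, ← mulVec_sub]
    congr 1
    refine Finset.sum_congr rfl fun i _ => ?_
    rw [hX i, hy i, hX i, add_sub_cancel_left, add_sub_assoc, ← dotProduct_sub, ← mulVec_sub,
      sub_add_cancel_left]
  have h3 := two_form_le hP.inv.posSemidef (E.block 0) (X.block 0 - st.x)
  have h4 : 2 * ∑ i : Fin F.T, ((E.block i.succ - F.A *ᵥ E.block i.castSucc) ⬝ᵥ Φ *ᵥ w i +
        (F.C *ᵥ E.block i.succ) ⬝ᵥ Ψ *ᵥ (-v i)) ≤
      ∑ i : Fin F.T, ((E.block i.succ - F.A *ᵥ E.block i.castSucc) ⬝ᵥ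
          Φ *ᵥ (E.block i.succ - F.A *ᵥ E.block i.castSucc) +
        (F.C *ᵥ E.block i.succ) ⬝ᵥ Ψ *ᵥ (F.C *ᵥ E.block i.succ)) +
      ∑ i : Fin F.T, (w i ⬝ᵥ Φ *ᵥ w i + v i ⬝ᵥ Ψ *ᵥ v i) := by
    rw [Finset.mul_sum, ← Finset.sum_add_distrib]
    refine Finset.sum_le_sum fun i _ => ?_
    have h5 := two_form_le hΦ.posSemidef (E.block i.succ - F.A *ᵥ E.block i.castSucc) (w i)
    have h6 := two_form_le hΨ.posSemidef (F.C *ᵥ E.block i.succ) (-v i)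
    have h7 : (-v i) ⬝ᵥ Ψ *ᵥ (-v i) = v i ⬝ᵥ Ψ *ᵥ v i := by
      rw [mulVec_neg, neg_dotProduct_neg]
    linarith
  have h7 := F.precision_form st.P Φ Ψ E E
  linarith

/-- The estimate at the end of the window is as accurate as the initial guess and the
disturbances allow, with a constant that does not depend on the data. -/
lemma exists_winError_le {p φ φ' ψ ψ' : ℝ} (hp : 0 < p) (hφ : 0 < φ) (hψ : 0 < ψ) :
    ∃ κ : ℝ, 0 ≤ κ ∧ ∀ (y : ℕ → Vec ny) (t : ℕ) (st : State nx ny) (Φ : Mat nx) (Ψ : Mat ny)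
      (X : WinVec F.T nx) (w : Fin F.T → Vec nx) (v : Fin F.T → Vec ny), st.P.PosDef →
      (∀ u, u ⬝ᵥ st.P *ᵥ u ≤ p * (u ⬝ᵥ u)) → Between φ φ' Φ → Between ψ ψ' Ψ →
      (∀ i : Fin F.T, X.block i.succ = F.A *ᵥ X.block i.castSucc + w i) →
      (∀ i : Fin F.T, y (t - F.T + (i + 1)) = F.C *ᵥ X.block i.succ + v i) →
      (WinVec.block (X - F.winMean y t st Φ Ψ) (Fin.last F.T)) ⬝ᵥ
        (WinVec.block (X - F.winMean y t st Φ Ψ) (Fin.last F.T)) ≤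
      κ * ((X.block 0 - st.x) ⬝ᵥ st.P⁻¹ *ᵥ (X.block 0 - st.x) +
        ∑ i : Fin F.T, (φ' * (w i ⬝ᵥ w i) + ψ' * (v i ⬝ᵥ v i))) := by
  obtain ⟨l, hl0, hl⟩ := exists_norm_mulVec_le F.A
  -- Forward propagation of `E_{i+1} = A E_i + (E_{i+1} - A E_i)`. No observability inside the
  -- window is needed, since block `0` is controlled by the prior term.
  have hgrow : ∀ a : Fin (F.T + 1), ∃ κ : ℝ, 0 ≤ κ ∧ ∀ (E : WinVec F.T nx) (J : ℝ), 0 ≤ J →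
      E.block 0 ⬝ᵥ E.block 0 ≤ p * J →
      (∀ i : Fin F.T, (E.block i.succ - F.A *ᵥ E.block i.castSucc) ⬝ᵥ
        (E.block i.succ - F.A *ᵥ E.block i.castSucc) ≤ φ⁻¹ * J) →
      E.block a ⬝ᵥ E.block a ≤ κ * J := by
    intro a
    induction a using Fin.induction with
    | zero => exact ⟨p, hp.le, fun E J _ h _ => h⟩
    | succ i ih =>
      obtain ⟨κ, hκ, h⟩ := ih
      refine ⟨2 * (l * κ) + 2 * φ⁻¹, by positivity, fun E J hJ h0 h1 => ?_⟩
      have h2 := add_dotProduct_self_le (F.A *ᵥ E.block i.castSucc)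
        (E.block i.succ - F.A *ᵥ E.block i.castSucc)
      rw [add_sub_cancel] at h2
      have h3 := h1 i
      have h4 := hl (E.block i.castSucc)
      have h5 := mul_le_mul_of_nonneg_left (h E J hJ h0 h1) hl0
      linarith
  obtain ⟨κ, hκ, hgrow⟩ := hgrow (Fin.last F.T)
  refine ⟨κ, hκ, fun y t st Φ Ψ X w v hP hPp hΦ hΨ hX hy => ?_⟩
  have hΦ' := hΦ.posDef hφ
  have hΨ' := hΨ.posDef hψ
  have h := F.winError_form_le y t hP hΦ' hΨ' hX hy rfl
  set E := X - F.winMean y t st Φ Ψ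
  set J := (X.block 0 - st.x) ⬝ᵥ st.P⁻¹ *ᵥ (X.block 0 - st.x) +
        ∑ i : Fin F.T, (φ' * (w i ⬝ᵥ w i) + ψ' * (v i ⬝ᵥ v i)) with hJdef
  have hJ : E ⬝ᵥ F.precision st.P Φ Ψ *ᵥ E ≤ J := by
    refine h.trans ?_
    rw [hJdef]
    gcongr with i
    · exact (hΦ.2 _).2
    · exact (hΨ.2 _).2
  rw [precision_form] at hJ
  have h0 := form_nonneg hP.inv.posSemidef (E.block 0)
  have hterm : ∀ i ∈ (Finset.univ : Finset (Fin F.T)),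
      0 ≤ (E.block (Fin.succ i) - F.A *ᵥ E.block i.castSucc) ⬝ᵥ
          Φ *ᵥ (E.block i.succ - F.A *ᵥ E.block i.castSucc) +
        (F.C *ᵥ E.block i.succ) ⬝ᵥ Ψ *ᵥ (F.C *ᵥ E.block i.succ) := fun i _ =>
      add_nonneg (form_nonneg hΦ'.posSemidef _) (form_nonneg hΨ'.posSemidef _)
  have hsum := Finset.sum_nonneg hterm
  refine hgrow E J (by linarith) ?_ fun i => ?_
  · refine (dotProduct_self_le_of_inv hP hp hPp _).trans ?_
    gcongr
    linarith
  · have h1 := Finset.single_le_sum hterm (Finset.mem_univ i)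
    have h2 := form_nonneg hΨ'.posSemidef (F.C *ᵥ E.block i.succ)
    rw [le_inv_mul_iff₀ hφ]
    have h3 := (hΦ.2 (E.block i.succ - F.A *ᵥ E.block i.castSucc)).1
    linarith

/-- The matrix that selects a block of a window vector. -/
def blockSelector (T d : ℕ) (a : Fin (T + 1)) : Matrix (Fin d) (Fin (T + 1) × Fin d) ℝ :=
  (1 : WinMat T d).submatrix (fun i => (a, i)) id

lemma block_eq_conj {T d : ℕ} (P : WinMat T d) (a b : Fin (T + 1)) :
    P.block a b = blockSelector T d a * P * (blockSelector T d b)ᵀ := by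
  ext i j
  simp [WinMat.block, blockSelector, Matrix.mul_apply, Matrix.one_apply]

/-- This is the covariance of `x_{i+1} - A x_i` when the window has covariance `P`. -/
lemma transition_posSemidef {T d : ℕ} {P : WinMat T d} (hP : P.PosSemidef) (A : Mat d)
    (i : Fin T) :
    (P.block i.succ i.succ + A * P.block i.castSucc i.castSucc * Aᵀ
      - P.block i.succ i.castSucc * Aᵀ - A * P.block i.castSucc i.succ).PosSemidef := by
  have h := hP.mul_mul_conjTranspose_same
    (blockSelector T d i.succ - A * blockSelector T d i.castSucc)
  convert h using 1
  simp only [block_eq_conj, conjTranspose_eq_transpose_of_trivial, Matrix.transpose_sub,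
    Matrix.transpose_mul, Matrix.sub_mul, Matrix.mul_sub, Matrix.mul_assoc]
  abel

/-- A positive definite scale matrix keeps the inverse Wishart weights positive. -/
lemma scaleM_posDef {st : State nx ny} (hM : st.M.PosDef) (x : WinVec F.T nx)
    {P : WinMat F.T nx} (hP : P.PosSemidef) : (F.scaleM st x P).PosDef := by
  refine hM.add_posSemidef (posSemidef_sum _ fun i _ => ?_)
  have h1 := transition_posSemidef hP F.A i
  have h2 := posSemidef_vecMulVec_self_star (x.block i.succ - F.A *ᵥ x.block i.castSucc)
  rw [star_trivial] at h2
  convert h2.add h1 using 1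
  abel

lemma scaleS_posDef (y : ℕ → Vec ny) (t : ℕ) {st : State nx ny} (hS : st.S.PosDef)
    (x : WinVec F.T nx) {P : WinMat F.T nx} (hP : P.PosSemidef) :
    (F.scaleS y t st x P).PosDef := by
  refine hS.add_posSemidef (posSemidef_sum _ fun i _ => ?_)
  have h1 : (P.block i.succ i.succ).PosSemidef := hP.submatrix fun j => (i.succ, j)
  have h2 := posSemidef_vecMulVec_self_star (y (t - F.T + (i + 1)) - F.C *ᵥ x.block i.succ)
  have h3 := h1.mul_mul_conjTranspose_same F.C
  rw [star_trivial] at h2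
  rw [conjTranspose_eq_transpose_of_trivial] at h3
  exact h2.add h3

end VBFilter

end Window

/-! ### Measurability of matrix inversion and of the density -/

section Measurability

variable {l m n : Type*}

instance matBorelSpace [Countable m] [Countable n] : BorelSpace (Matrix m n ℝ) :=
  inferInstanceAs (BorelSpace (m → n → ℝ))

/-- Inversion is not continuous at singular matrices, but the cofactor formula, with `0⁻¹ = 0`, is
measurable everywhere. -/
lemma measurable_matrix_inv [Fintype n] [DecidableEq n] :
    Measurable fun G : Matrix n n ℝ => G⁻¹ := by
  have h : (fun G : Matrix n n ℝ => G⁻¹) = fun G => (G.det)⁻¹ • G.adjugate := by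
    ext1 G
    rw [Matrix.inv_def, Ring.inverse_eq_inv']
  have hdet : Measurable fun G : Matrix n n ℝ => (G.det)⁻¹ :=
    (Continuous.matrix_det continuous_id).measurable.inv
  have hadj : ∀ i j, Measurable fun G : Matrix n n ℝ => G.adjugate i j := fun i j =>
    ((Continuous.matrix_adjugate continuous_id).matrix_elem i j).measurable
  rw [h]
  exact measurable_pi_iff.2 fun i => measurable_pi_iff.2 fun j => hdet.mul (hadj i j)

lemma measurable_matrix_elem (i : m) (j : n) : Measurable fun G : Matrix m n ℝ => G i j :=
  (measurable_pi_apply j).comp (measurable_pi_apply i)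

lemma measurable_invWishart {X : Type*} [MeasurableSpace X] {d : ℕ} {G Δ : X → Mat d}
    (hG : Measurable G) (hΔ : Measurable Δ) (γ : ℝ) :
    Measurable fun x => invWishart (G x) (Δ x) γ := by
  have hdet : Measurable fun G : Mat d => G.det :=
    (Continuous.matrix_det continuous_id).measurable
  have h1 : Measurable fun x => (Δ x).det := hdet.comp hΔ
  have h2 : Measurable fun x => (G x).det := hdet.comp hG
  have h3 : Measurable fun x => (G x)⁻¹ := measurable_matrix_inv.comp hG
  have h4 : Measurable fun x => (Δ x * (G x)⁻¹).trace := by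
    simp only [Matrix.trace, Matrix.diag_apply, Matrix.mul_apply]
    exact Finset.measurable_fun_sum _ fun i _ => Finset.measurable_fun_sum _ fun j _ =>
      ((measurable_matrix_elem i j).comp hΔ).mul ((measurable_matrix_elem j i).comp h3)
  have h5 : Measurable fun x => Real.exp (-(Δ x * (G x)⁻¹).trace / 2) :=
    Real.measurable_exp.comp (h4.neg.div_const _)
  simp only [invWishart]
  exact (((h1.pow_const _).div_const _).mul (h2.pow_const _)).mul h5

end Measurability

/-! ### Constrained means, exact or sampled, keep Loewner bounds -/

section Means

variable {d : ℕ} {a b : ℝ}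

lemma LoewnerBounded.between {𝒮 : Set (Mat d)} (h : LoewnerBounded 𝒮 a b) {G : Mat d}
    (hG : G ∈ 𝒮) : Between a b G := by
  obtain ⟨h1, h2⟩ := h G hG
  refine ⟨?_, fun u => ?_⟩
  · have h3 := isSymm_of_posSemidef h1
    have h4 : (a • (1 : Mat d)).IsSymm := by simp [Matrix.IsSymm]
    simpa using h3.add h4
  · have h3 := form_nonneg h1 u
    have h4 := form_nonneg h2 u
    simp only [sub_mulVec, dotProduct_sub, smul_mulVec, one_mulVec, dotProduct_smul,
      smul_eq_mul] at h3 h4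
    constructor <;> linarith

/-- Inversion reverses Loewner bounds. -/
lemma Between.inv {G : Mat d} (h : Between a b G) (ha : 0 < a) (hab : a ≤ b) :
    Between b⁻¹ a⁻¹ G⁻¹ := by
  have hG := h.posDef ha
  have hb : 0 < b := ha.trans_le hab
  refine ⟨isSymm_of_posDef hG.inv, fun u => ⟨?_, ?_⟩⟩
  · rw [inv_mul_le_iff₀ hb]
    exact dotProduct_self_le_of_inv hG hb (fun z => (h.2 z).2) u
  · have hu : G *ᵥ (G⁻¹ *ᵥ u) = u := by
      rw [mulVec_mulVec, Matrix.mul_nonsing_inv _ ((Matrix.isUnit_iff_isUnit_det _).1 hG.isUnit),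
        one_mulVec]
    have h1 := (h.2 (G⁻¹ *ᵥ u)).1
    have h2 := two_dotProduct_le_self ha (G⁻¹ *ᵥ u) u
    rw [hu] at h1
    rw [dotProduct_comm u]
    linarith

lemma Between.abs_form_le {G : Mat d} (h : Between a b G) (u : Vec d) :
    |u ⬝ᵥ G *ᵥ u| ≤ (|a| + |b|) * (u ⬝ᵥ u) := by
  have h0 := dotProduct_self_nonneg_real u
  have h1 := mul_le_mul_of_nonneg_right (neg_abs_le a) h0
  have h2 := mul_le_mul_of_nonneg_right (le_abs_self b) h0
  have h3 := mul_nonneg (abs_nonneg a) h0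
  have h4 := mul_nonneg (abs_nonneg b) h0
  rw [abs_le]
  constructor <;> linarith [(h.2 u).1, (h.2 u).2]

/-- Polarization with `e_i + e_j` and `e_i - e_j`, whose squared norms are at most `4`. -/
lemma Between.abs_elem_le {G : Mat d} (h : Between a b G) (i j : Fin d) :
    |G i j| ≤ 2 * (|a| + |b|) := by
  have hs : G j i = G i j := h.1.apply i j
  set e : Fin d → Vec d := fun k => Pi.single k 1
  have he : ∀ k, e k ⬝ᵥ e k = 1 := fun k => by simp [e]
  have hG : ∀ k k', e k ⬝ᵥ G *ᵥ e k' = G k k' := fun k k' => by simp [e]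
  have hc : 0 ≤ |a| + |b| := by positivity
  have h1 := h.abs_form_le (e i + e j)
  have h2 := h.abs_form_le (e i + -e j)
  have h3 := mul_le_mul_of_nonneg_left (add_dotProduct_self_le (e i) (e j)) hc
  have h4 := mul_le_mul_of_nonneg_left (add_dotProduct_self_le (e i) (-e j)) hc
  rw [neg_dotProduct_neg, he, he] at h4
  rw [he, he] at h3
  have h5 := abs_le.1 (h1.trans h3)
  have h6 := abs_le.1 (h2.trans h4)
  simp only [mulVec_add, mulVec_neg, add_dotProduct, dotProduct_add, neg_dotProduct,
    dotProduct_neg, hG, hs] at h5 h6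
  rw [abs_le]
  constructor <;> linarith [h5.1, h5.2, h6.1, h6.2]

/-- Closed conditions inside a box of entries. Compactness bounds the density, and the same box, in
the coordinates of `symVolume`, gives finite volume. -/
lemma isCompact_between (a b : ℝ) : IsCompact {G : Mat d | Between a b G} := by
  have hbox : IsCompact (Set.pi Set.univ fun _ : Fin d => Set.pi Set.univ fun _ : Fin d =>
      Set.Icc (-(2 * (|a| + |b|))) (2 * (|a| + |b|))) :=
    isCompact_univ_pi fun _ => isCompact_univ_pi fun _ => isCompact_Icc
  refine IsCompact.of_isClosed_subset (X := Mat d) hbox ?_ fun G hG i _ j _ =>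
    abs_le.1 (hG.abs_elem_le i j)
  have hset : {G : Mat d | Between a b G} = {G | Gᵀ = G} ∩
      ⋂ u : Vec d, {G | a * (u ⬝ᵥ u) ≤ u ⬝ᵥ G *ᵥ u} ∩ {G | u ⬝ᵥ G *ᵥ u ≤ b * (u ⬝ᵥ u)} := by
    ext G
    simp [Between, Matrix.IsSymm]
  rw [hset]
  refine (isClosed_eq (by fun_prop) (by fun_prop)).inter (isClosed_iInter fun u => ?_)
  exact (isClosed_le (by fun_prop) (by fun_prop)).inter (isClosed_le (by fun_prop) (by fun_prop))

lemma symVolume_between_lt_top (a b : ℝ) : symVolume d {G : Mat d | Between a b G} < ⊤ := by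
  have hmeas : Measurable fun (u : Sym2 (Fin d) → ℝ) =>
      (Matrix.of fun i j => u s(i, j) : Mat d) :=
    measurable_pi_iff.2 fun i => measurable_pi_iff.2 fun j => measurable_pi_apply _
  rw [symVolume, Measure.map_apply hmeas (isCompact_between a b).isClosed.measurableSet]
  have hbox : IsCompact (Set.pi Set.univ fun _ : Sym2 (Fin d) =>
      Set.Icc (-(2 * (|a| + |b|))) (2 * (|a| + |b|))) :=
    isCompact_univ_pi fun _ => isCompact_Icc
  refine lt_of_le_of_lt (measure_mono ?_) hbox.measure_lt_top
  intro u hu s _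
  induction s using Sym2.ind with
  | _ i j => exact abs_le.1 (Between.abs_elem_le (G := Matrix.of fun i j => u s(i, j)) hu i j)

lemma multivariateGamma_pos {γ : ℝ} (hγ : (d : ℝ) + 1 < γ) :
    0 < multivariateGamma d (γ / 2) := by
  refine mul_pos (Real.rpow_pos_of_pos Real.pi_pos _) (Finset.prod_pos fun j _ => ?_)
  refine Real.Gamma_pos_of_pos ?_
  have : (j : ℝ) < d := by exact_mod_cast j.2
  linarith

lemma invWishart_pos {G Δ : Mat d} (hG : G.PosDef) (hΔ : Δ.PosDef) {γ : ℝ}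
    (hγ : (d : ℝ) + 1 < γ) : 0 < invWishart G Δ γ := by
  have h1 := Real.rpow_pos_of_pos hΔ.det_pos (γ / 2)
  have h2 := multivariateGamma_pos hγ
  have h3 := Real.rpow_pos_of_pos hG.det_pos (-(γ + d + 1) / 2)
  unfold invWishart
  positivity

lemma exists_invWishart_le (ha : 0 < a) (Δ : Mat d) (γ : ℝ) :
    ∃ B, ∀ G : Mat d, Between a b G → ‖invWishart G Δ γ‖ ≤ B := by
  refine (isCompact_between a b).exists_bound_of_continuousOn ?_
  have hdet : ContinuousOn (fun G : Mat d => G.det) {G | Between a b G} :=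
    (Continuous.matrix_det continuous_id).continuousOn
  have hne : ∀ G ∈ {G : Mat d | Between a b G}, G.det ≠ 0 := fun G hG =>
    (Between.posDef hG ha).det_pos.ne'
  have hinv : ContinuousOn (fun G : Mat d => G⁻¹) {G | Between a b G} := by
    have h : (fun G : Mat d => G⁻¹) = fun G => (G.det)⁻¹ • G.adjugate := by
      ext1 G
      rw [Matrix.inv_def, Ring.inverse_eq_inv']
    rw [h]
    exact (hdet.inv₀ hne).smul (Continuous.matrix_adjugate continuous_id).continuousOn
  have htr : ContinuousOn (fun G : Mat d => (Δ * G⁻¹).trace) {G | Between a b G} := by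
    have h : Continuous fun G : Mat d => (Δ * G).trace := by fun_prop
    exact h.comp_continuousOn hinv
  unfold invWishart
  exact (continuousOn_const.mul (hdet.rpow_const fun G hG => Or.inl (hne G hG))).mul
    (Real.continuous_exp.comp_continuousOn (htr.neg.div_const _))

variable {𝒮 : Set (Mat d)} {a₀ b₀ : ℝ}

lemma integrableOn_mul_invWishart (hbd : LoewnerBounded 𝒮 a₀ b₀) (ha₀ : 0 < a₀)
    (hm : MeasurableSet 𝒮) {g : Mat d → ℝ} (hg : Measurable g) {B : ℝ}
    (hB : ∀ G ∈ 𝒮, ‖g G‖ ≤ B) (Δ : Mat d) (γ : ℝ) :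
    IntegrableOn (fun G => g G * invWishart G Δ γ) 𝒮 (symVolume d) := by
  obtain ⟨B', hB'⟩ := exists_invWishart_le (d := d) (b := b₀) ha₀ Δ γ
  have hW : Measurable fun G : Mat d => invWishart G Δ γ :=
    measurable_invWishart measurable_id measurable_const γ
  refine Measure.integrableOn_of_bounded (M := B * B') ?_ (hg.mul hW).aestronglyMeasurable ?_
  · exact (lt_of_le_of_lt (measure_mono fun G hG => hbd.between hG)
      (symVolume_between_lt_top a₀ b₀)).ne
  · filter_upwards [ae_restrict_mem hm] with G hG
    rw [norm_mul]
    exact mul_le_mul (hB G hG) (hB' G (hbd.between hG)) (norm_nonneg _)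
      ((norm_nonneg _).trans (hB G hG))

/-- The quadratic form of the mean is the mean of the quadratic forms under a probability weight.
Integrability holds because `f` and the density are bounded on a set of finite volume. -/
lemma constrainedMean_between (hm : MeasurableSet 𝒮) (hbd : LoewnerBounded 𝒮 a₀ b₀)
    (ha₀ : 0 < a₀) (hvol : 0 < symVolume d 𝒮) {f : Mat d → Mat d} (hf : Measurable f)
    (hfb : ∀ G ∈ 𝒮, Between a b (f G)) {Δ : Mat d} (hΔ : Δ.PosDef) {γ : ℝ}
    (hγ : (d : ℝ) + 1 < γ) : Between a b (constrainedMean 𝒮 f Δ γ) := by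
  have hpos : ∀ G ∈ 𝒮, 0 < invWishart G Δ γ := fun G hG =>
    invWishart_pos ((hbd.between hG).posDef ha₀) hΔ hγ
  have hfij : ∀ i j, Measurable fun G => f G i j := fun i j =>
    (measurable_matrix_elem i j).comp hf
  have h_int : ∀ i j, IntegrableOn (fun G => f G i j * invWishart G Δ γ) 𝒮 (symVolume d) :=
    fun i j => integrableOn_mul_invWishart hbd ha₀ hm (hfij i j)
      (fun G hG => (hfb G hG).abs_elem_le i j) Δ γ
  have h_int1 : IntegrableOn (fun G => invWishart G Δ γ) 𝒮 (symVolume d) := by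
    simpa using integrableOn_mul_invWishart hbd ha₀ hm (g := fun _ => 1) measurable_const
      (B := 1) (by simp) Δ γ
  -- A positive density over a set of positive volume.
  have hD : 0 < ∫ G in 𝒮, invWishart G Δ γ ∂symVolume d := by
    rw [setIntegral_pos_iff_support_of_nonneg_ae _ h_int1]
    · refine lt_of_lt_of_le hvol (measure_mono fun G hG => ⟨(hpos G hG).ne', hG⟩)
    · filter_upwards [ae_restrict_mem hm] with G hG using (hpos G hG).le
  have hsymm : (constrainedMean 𝒮 f Δ γ).IsSymm := by
    ext i j
    simp only [constrainedMean, Matrix.transpose_apply, Matrix.of_apply]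
    congr 1
    refine setIntegral_congr_fun hm fun G hG => ?_
    rw [(hfb G hG).1.apply]
  have hexp : ∀ (u : Vec d) (M : Mat d), u ⬝ᵥ M *ᵥ u = ∑ i, ∑ j, u i * u j * M i j := by
    intro u M
    simp only [dotProduct, mulVec, Finset.mul_sum]
    exact Finset.sum_congr rfl fun i _ => Finset.sum_congr rfl fun j _ => by ring
  have h_int2 : ∀ (u : Vec d) (i j : Fin d), Integrable
      (fun G => u i * u j * f G i j * invWishart G Δ γ) ((symVolume d).restrict 𝒮) := by
    intro u i j
    simpa only [mul_assoc] using ((h_int i j).const_mul (u j)).const_mul (u i)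
  have hformint : ∀ u : Vec d, IntegrableOn (fun G => (u ⬝ᵥ f G *ᵥ u) * invWishart G Δ γ) 𝒮
      (symVolume d) := by
    intro u
    simp only [hexp, Finset.sum_mul]
    refine integrable_finsetSum _ fun i _ => integrable_finsetSum _ fun j _ => h_int2 u i j
  have hform : ∀ u : Vec d, u ⬝ᵥ constrainedMean 𝒮 f Δ γ *ᵥ u =
      (∫ G in 𝒮, (u ⬝ᵥ f G *ᵥ u) * invWishart G Δ γ ∂symVolume d) /
        ∫ G in 𝒮, invWishart G Δ γ ∂symVolume d := by
    intro u
    simp only [hexp, Finset.sum_mul]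
    rw [integral_finsetSum _ fun i _ => integrable_finsetSum _ fun j _ => h_int2 u i j,
      Finset.sum_div]
    refine Finset.sum_congr rfl fun i _ => ?_
    rw [integral_finsetSum _ fun j _ => h_int2 u i j, Finset.sum_div]
    refine Finset.sum_congr rfl fun j _ => ?_
    simp only [mul_assoc, integral_const_mul, constrainedMean, Matrix.of_apply]
    ring
  refine ⟨hsymm, fun u => ?_⟩
  rw [hform, le_div_iff₀ hD, div_le_iff₀ hD, ← integral_const_mul, ← integral_const_mul]
  constructor
  · refine setIntegral_mono_on (h_int1.const_mul _) (hformint u) hm fun G hG => ?_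
    exact mul_le_mul_of_nonneg_right ((hfb G hG).2 u).1 (hpos G hG).le
  · refine setIntegral_mono_on (hformint u) (h_int1.const_mul _) hm fun G hG => ?_
    exact mul_le_mul_of_nonneg_right ((hfb G hG).2 u).2 (hpos G hG).le

/-- A normalized nonnegative combination of matrices keeps common Loewner bounds. -/
lemma between_normalized_sum {J : ℕ} {c : Fin J → ℝ} (hc : ∀ j, 0 ≤ c j) (hs : 0 < ∑ j, c j)
    {M : Fin J → Mat d} (hM : ∀ j, c j ≠ 0 → Between a b (M j)) :
    Between a b ((∑ j, c j)⁻¹ • ∑ j, c j • M j) := by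
  refine ⟨?_, fun u => ?_⟩
  · rw [Matrix.IsSymm, Matrix.transpose_smul, Matrix.transpose_sum]
    congr 1
    refine Finset.sum_congr rfl fun j _ => ?_
    by_cases h : c j = 0
    · simp [h]
    · rw [Matrix.transpose_smul, (hM j h).1.eq]
  · have hform : u ⬝ᵥ ((∑ j, c j)⁻¹ • ∑ j, c j • M j) *ᵥ u =
        (∑ j, c j)⁻¹ * ∑ j, c j * (u ⬝ᵥ M j *ᵥ u) := by
      rw [smul_mulVec, dotProduct_smul, sum_mulVec, dotProduct_sum, smul_eq_mul]
      simp only [smul_mulVec, dotProduct_smul, smul_eq_mul]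
    rw [hform, le_inv_mul_iff₀ hs, inv_mul_le_iff₀ hs, Finset.sum_mul, Finset.sum_mul]
    constructor <;>
    · refine Finset.sum_le_sum fun j _ => ?_
      by_cases h : c j = 0
      · simp [h]
      · exact mul_le_mul_of_nonneg_left (by first | exact ((hM j h).2 u).1 | exact ((hM j h).2 u).2)
          (hc j)

lemma importanceMean_between {J : ℕ} (hpd : ∀ G ∈ 𝒮, G.PosDef) {G : Fin J → Mat d}
    {π : Mat d → ℝ} (hπ : ∀ j, G j ∈ 𝒮 → 0 < π (G j)) (hex : ∃ j, G j ∈ 𝒮)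
    {f : Mat d → Mat d} (hfb : ∀ G ∈ 𝒮, Between a b (f G)) {Δ : Mat d} (hΔ : Δ.PosDef) {γ : ℝ}
    (hγ : (d : ℝ) + 1 < γ) : Between a b (importanceMean 𝒮 G π f Δ γ) := by
  have hpos : ∀ j, G j ∈ 𝒮 → 0 < 𝒮.indicator (fun H => invWishart H Δ γ / π H) (G j) :=
    fun j hj => by
      rw [Set.indicator_of_mem hj]
      exact div_pos (invWishart_pos (hpd _ hj) hΔ hγ) (hπ j hj)
  have hnn : ∀ j, 0 ≤ 𝒮.indicator (fun H => invWishart H Δ γ / π H) (G j) := fun j => by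
    by_cases h : G j ∈ 𝒮
    · exact (hpos j h).le
    · rw [Set.indicator_of_notMem h]
  refine between_normalized_sum hnn ?_ fun j hj => hfb _ (Set.mem_of_indicator_ne_zero hj)
  obtain ⟨j, hj⟩ := hex
  exact Finset.sum_pos' (fun j _ => hnn j) ⟨j, Finset.mem_univ j, hpos j hj⟩

/-- The outcome `ω` is one for which the integrator is meaningful. -/
def Integrator.Proper {Ω : Type*} (I : Integrator Ω d) (ω : Ω) (𝒮 : Set (Mat d)) : Prop :=
  match I with
  | .exact => True
  | .sampled _ G π => (∀ j, G j ω ∈ 𝒮 → 0 < π ω (G j ω)) ∧ ∃ j, G j ω ∈ 𝒮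

lemma Integrator.Admissible.ae_proper {Ω : Type*} [MeasurableSpace Ω] {μ : Measure Ω}
    {I : Integrator Ω d} (hI : I.Admissible μ 𝒮) : ∀ᵐ ω ∂μ, I.Proper ω 𝒮 := by
  cases I with
  | exact => exact ae_of_all _ fun _ => trivial
  | sampled J G π => exact hI.2.2

/-- The bounds depend neither on the scale matrix, nor on the samples or their number. Through this
lemma the whole adaptive part of the filter enters as bounded coefficients. -/
lemma Integrator.Proper.mean_between {Ω : Type*} {I : Integrator Ω d} {ω : Ω}
    (hI : I.Proper ω 𝒮) (hm : MeasurableSet 𝒮) (hbd : LoewnerBounded 𝒮 a₀ b₀)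
    (ha₀ : 0 < a₀) (hvol : 0 < symVolume d 𝒮) {f : Mat d → Mat d} (hf : Measurable f)
    (hfb : ∀ G ∈ 𝒮, Between a b (f G)) {Δ : Mat d} (hΔ : Δ.PosDef) {γ : ℝ}
    (hγ : (d : ℝ) + 1 < γ) : Between a b (I.mean ω 𝒮 f Δ γ) := by
  cases I with
  | exact => exact constrainedMean_between hm hbd ha₀ hvol hf hfb hΔ hγ
  | sampled J G π =>
    exact importanceMean_between (fun G hG => (hbd.between hG).posDef ha₀) hI.1 hI.2 hfb hΔ hγ

lemma measurable_constrainedMean (𝒮 : Set (Mat d)) {f : Mat d → Mat d} (hf : Measurable f) (γ : ℝ) :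
    Measurable fun Δ => constrainedMean 𝒮 f Δ γ := by
  have : SFinite (symVolume d) := by unfold symVolume; infer_instance
  have hW : Measurable fun p : Mat d × Mat d => invWishart p.2 p.1 γ :=
    measurable_invWishart measurable_snd measurable_fst γ
  refine measurable_pi_iff.2 fun i => measurable_pi_iff.2 fun j => Measurable.div ?_ ?_
  · have h : Measurable fun p : Mat d × Mat d => f p.2 i j * invWishart p.2 p.1 γ :=
      ((measurable_matrix_elem i j).comp (hf.comp measurable_snd)).mul hW
    exact h.stronglyMeasurable.integral_prod_right'.measurable
  · exact hW.stronglyMeasurable.integral_prod_right'.measurable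

/-- Joint measurability is needed because the scale matrix is itself random. -/
lemma Integrator.Admissible.measurable_mean {Ω : Type*} [MeasurableSpace Ω] {μ : Measure Ω}
    {I : Integrator Ω d} (hI : I.Admissible μ 𝒮) (hm : MeasurableSet 𝒮) {f : Mat d → Mat d}
    (hf : Measurable f) (γ : ℝ) :
    Measurable fun p : Ω × Mat d => I.mean p.1 𝒮 f p.2 γ := by
  cases I with
  | exact => exact (measurable_constrainedMean 𝒮 hf γ).comp measurable_snd
  | sampled J G π =>
    obtain ⟨hG, hπ, -⟩ := hI
    have hG' : ∀ j, Measurable fun p : Ω × Mat d => G j p.1 := fun j => (hG j).comp measurable_fst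
    have hc : ∀ j, Measurable fun p : Ω × Mat d =>
        𝒮.indicator (fun H => invWishart H p.2 γ / π p.1 H) (G j p.1) := by
      intro j
      have h1 : Measurable fun p : Ω × Mat d => invWishart (G j p.1) p.2 γ / π p.1 (G j p.1) :=
        (measurable_invWishart (hG' j) measurable_snd γ).div
          (hπ.comp (measurable_fst.prodMk (hG' j)))
      exact h1.indicator ((hG' j) hm)
    refine measurable_pi_iff.2 fun i => measurable_pi_iff.2 fun k => ?_
    simp only [Integrator.mean, importanceMean, Matrix.smul_apply, Matrix.sum_apply, smul_eq_mul]
    refine Measurable.mul (Measurable.inv (Finset.measurable_fun_sum _ fun j _ => hc j))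
      (Finset.measurable_fun_sum _ fun j _ => (hc j).mul ?_)
    exact (measurable_matrix_elem i k).comp (hf.comp (hG' j))

end Means

/-! ### Measurability of the filter along its recursion -/

section AEMeasurability

variable {Ω : Type*} [MeasurableSpace Ω] {μ : Measure Ω}

section Matrices

variable {l m n : Type*}

instance matSecondCountable [Countable m] [Countable n] :
    SecondCountableTopology (Matrix m n ℝ) :=
  inferInstanceAs (SecondCountableTopology (m → n → ℝ))

lemma aemeasurable_matrix [Countable m] [Countable n] {f : Ω → Matrix m n ℝ}
    (h : ∀ i j, AEMeasurable (fun ω => f ω i j) μ) : AEMeasurable f μ :=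
  aemeasurable_pi_iff.2 fun i => aemeasurable_pi_iff.2 fun j => h i j

lemma aemeasurable_elem {f : Ω → Matrix m n ℝ} (hf : AEMeasurable f μ) (i : m) (j : n) :
    AEMeasurable (fun ω => f ω i j) μ :=
  (measurable_matrix_elem i j).comp_aemeasurable hf

lemma aemeasurable_mul [Countable l] [Fintype m] [Countable n] {f : Ω → Matrix l m ℝ}
    {g : Ω → Matrix m n ℝ} (hf : AEMeasurable f μ) (hg : AEMeasurable g μ) :
    AEMeasurable (fun ω => f ω * g ω) μ :=
  aemeasurable_matrix fun i j => by
    simp only [Matrix.mul_apply]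
    exact Finset.aemeasurable_fun_sum _ fun k _ =>
      (aemeasurable_elem hf i k).mul (aemeasurable_elem hg k j)

lemma aemeasurable_mulVec [Countable l] [Fintype m] {f : Ω → Matrix l m ℝ}
    {g : Ω → m → ℝ} (hf : AEMeasurable f μ) (hg : AEMeasurable g μ) :
    AEMeasurable (fun ω => f ω *ᵥ g ω) μ :=
  aemeasurable_pi_iff.2 fun i => by
    simp only [mulVec, dotProduct]
    exact Finset.aemeasurable_fun_sum _ fun k _ =>
      (aemeasurable_elem hf i k).mul (aemeasurable_pi_iff.1 hg k)

lemma aemeasurable_vecMulVec [Countable m] [Countable n] {f : Ω → m → ℝ} {g : Ω → n → ℝ}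
    (hf : AEMeasurable f μ) (hg : AEMeasurable g μ) :
    AEMeasurable (fun ω => vecMulVec (f ω) (g ω)) μ :=
  aemeasurable_matrix fun i j => (aemeasurable_pi_iff.1 hf i).mul (aemeasurable_pi_iff.1 hg j)

lemma aemeasurable_inv [Fintype n] [DecidableEq n] {f : Ω → Matrix n n ℝ}
    (hf : AEMeasurable f μ) : AEMeasurable (fun ω => (f ω)⁻¹) μ :=
  measurable_matrix_inv.comp_aemeasurable hf

lemma aemeasurable_block {T d : ℕ} {f : Ω → WinMat T d} (hf : AEMeasurable f μ)
    (a b : Fin (T + 1)) : AEMeasurable (fun ω => (f ω).block a b) μ :=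
  aemeasurable_matrix fun i j => aemeasurable_elem hf (a, i) (b, j)

lemma aemeasurable_vecBlock {T d : ℕ} {f : Ω → WinVec T d} (hf : AEMeasurable f μ)
    (a : Fin (T + 1)) : AEMeasurable (fun ω => (f ω).block a) μ :=
  aemeasurable_pi_iff.2 fun i => aemeasurable_pi_iff.1 hf (a, i)

end Matrices

/-- The random components of the state are measurable, the degrees of freedom deterministic. -/
structure State.AEMeas {nx ny : ℕ} (μ : Measure Ω) (st : Ω → State nx ny) : Prop where
  x : AEMeasurable (fun ω => (st ω).x) μ
  P : AEMeasurable (fun ω => (st ω).P) μ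
  M : AEMeasurable (fun ω => (st ω).M) μ
  S : AEMeasurable (fun ω => (st ω).S) μ
  Φ : AEMeasurable (fun ω => (st ω).Φ) μ
  Ψ : AEMeasurable (fun ω => (st ω).Ψ) μ
  m : ∃ r, ∀ ω, (st ω).m = r
  s : ∃ r, ∀ ω, (st ω).s = r

/-- Since the degrees of freedom do not depend on the outcome, measurability in `γ` never arises. -/
lemma Integrator.Admissible.aemeasurable_mean {d : ℕ} {𝒮 : Set (Mat d)}
    {I : Integrator Ω d} (hI : I.Admissible μ 𝒮) (hm : MeasurableSet 𝒮) {f : Mat d → Mat d}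
    (hf : Measurable f) {Δ : Ω → Mat d} (hΔ : AEMeasurable Δ μ) {γ : Ω → ℝ}
    (hγ : ∃ r, ∀ ω, γ ω = r) :
    AEMeasurable (fun ω => I.mean ω 𝒮 f (Δ ω) (γ ω)) μ := by
  obtain ⟨r, hr⟩ := hγ
  obtain rfl : γ = fun _ => r := funext hr
  have h : AEMeasurable (fun ω => (ω, Δ ω)) μ := aemeasurable_id'.prodMk hΔ
  have h' := (hI.measurable_mean hm hf r).comp_aemeasurable h
  simpa only [Function.comp_def] using h'

namespace VBFilter

variable {nx ny : ℕ} (F : VBFilter Ω nx ny) {st : Ω → State nx ny}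
  {Φ : Ω → Mat nx} {Ψ : Ω → Mat ny} {y : ℕ → Ω → Vec ny}

lemma aemeasurable_winCov (hst : State.AEMeas μ st) (hΦ : AEMeasurable Φ μ)
    (hΨ : AEMeasurable Ψ μ) : AEMeasurable (fun ω => F.winCov (st ω) (Φ ω) (Ψ ω)) μ := by
  refine aemeasurable_inv (aemeasurable_matrix fun p q => ?_)
  refine aemeasurable_elem (f := fun ω => F.precisionBlock (st ω).P (Φ ω) (Ψ ω) p.1 q.1)
    ?_ p.2 q.2
  have hinv := aemeasurable_inv hst.P
  have h1 : AEMeasurable (fun ω => F.Cᵀ * Ψ ω * F.C) μ :=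
    aemeasurable_mul (aemeasurable_mul aemeasurable_const hΨ) aemeasurable_const
  have h2 : AEMeasurable (fun ω => F.Aᵀ * Φ ω * F.A) μ :=
    aemeasurable_mul (aemeasurable_mul aemeasurable_const hΦ) aemeasurable_const
  have h3 : AEMeasurable (fun ω => -(Φ ω * F.A)) μ :=
    (aemeasurable_mul hΦ aemeasurable_const).neg
  have h4 : AEMeasurable (fun ω => -(F.Aᵀ * Φ ω)) μ :=
    (aemeasurable_mul aemeasurable_const hΦ).neg
  have h5 := h1.add hΦ
  unfold precisionBlock
  split_ifs
  · exact hinv.add h2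
  · exact hinv.add aemeasurable_const
  · exact h5.add h2
  · exact h5.add aemeasurable_const
  · exact h3
  · exact h4
  · exact aemeasurable_const

lemma aemeasurable_winMean (hst : State.AEMeas μ st) (hΦ : AEMeasurable Φ μ)
    (hΨ : AEMeasurable Ψ μ) (hy : ∀ t, 1 ≤ t → AEMeasurable (y t) μ) (t : ℕ) :
    AEMeasurable (fun ω => F.winMean (fun k => y k ω) t (st ω) (Φ ω) (Ψ ω)) μ := by
  refine aemeasurable_mulVec (F.aemeasurable_winCov hst hΦ hΨ)
    (aemeasurable_pi_iff.2 fun p => ?_)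
  unfold infoVec
  by_cases hp : (p.1 : ℕ) = 0
  · simp only [if_pos hp]
    exact aemeasurable_pi_iff.1 (aemeasurable_mulVec (aemeasurable_inv hst.P) hst.x) p.2
  · simp only [if_neg hp]
    exact aemeasurable_pi_iff.1 (aemeasurable_mulVec (aemeasurable_mul aemeasurable_const hΨ)
      (hy _ (by omega))) p.2

lemma aemeasurable_iterM (hst : State.AEMeas μ st) (hΦ : AEMeasurable Φ μ)
    (hΨ : AEMeasurable Ψ μ) (hy : ∀ t, 1 ≤ t → AEMeasurable (y t) μ) (t : ℕ) :
    AEMeasurable (fun ω => F.iterM (fun k => y k ω) t (st ω) (Φ ω) (Ψ ω)) μ := by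
  have hx := F.aemeasurable_winMean hst hΦ hΨ hy t
  have hP := F.aemeasurable_winCov hst hΦ hΨ
  refine hst.M.add (Finset.aemeasurable_fun_sum _ fun i _ => ?_)
  have he := (aemeasurable_vecBlock hx i.succ).sub
    (aemeasurable_mulVec (aemeasurable_const (b := F.A)) (aemeasurable_vecBlock hx i.castSucc))
  exact ((((aemeasurable_vecMulVec he he).add (aemeasurable_block hP _ _)).add
    (aemeasurable_mul (aemeasurable_mul aemeasurable_const (aemeasurable_block hP _ _))
      aemeasurable_const)).sub (aemeasurable_mul (aemeasurable_block hP _ _)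
      aemeasurable_const)).sub (aemeasurable_mul aemeasurable_const (aemeasurable_block hP _ _))

lemma aemeasurable_iterS (hst : State.AEMeas μ st) (hΦ : AEMeasurable Φ μ)
    (hΨ : AEMeasurable Ψ μ) (hy : ∀ t, 1 ≤ t → AEMeasurable (y t) μ) (t : ℕ) :
    AEMeasurable (fun ω => F.iterS (fun k => y k ω) t (st ω) (Φ ω) (Ψ ω)) μ := by
  have hx := F.aemeasurable_winMean hst hΦ hΨ hy t
  have hP := F.aemeasurable_winCov hst hΦ hΨ
  refine hst.S.add (Finset.aemeasurable_fun_sum _ fun i _ => ?_)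
  have he := (hy (t - F.T + (i + 1)) (by omega)).sub
    (aemeasurable_mulVec (aemeasurable_const (b := F.C)) (aemeasurable_vecBlock hx i.succ))
  exact (aemeasurable_vecMulVec he he).add
    (aemeasurable_mul (aemeasurable_mul aemeasurable_const (aemeasurable_block hP _ _))
      aemeasurable_const)

variable {F}

lemma Admissible.aemeasurable_variational (hF : F.Admissible μ) (hst : State.AEMeas μ st)
    (hy : ∀ t, 1 ≤ t → AEMeasurable (y t) μ) {t : ℕ} (ht : F.T ≤ t) (k : ℕ) (hk : k ≤ F.N) :
    AEMeasurable (fun ω => (F.variational ω (fun k => y k ω) t (st ω) k).1) μ ∧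
      AEMeasurable (fun ω => (F.variational ω (fun k => y k ω) t (st ω) k).2) μ := by
  induction k with
  | zero => exact ⟨hst.Φ, hst.Ψ⟩
  | succ k ih =>
    obtain ⟨h1, h2⟩ := ih (by omega)
    obtain ⟨m, hm⟩ := hst.m
    obtain ⟨s, hs⟩ := hst.s
    exact ⟨(hF.adm_Φ t (k + 1) ht (by omega) hk).aemeasurable_mean hF.meas_𝒬 measurable_matrix_inv
        (F.aemeasurable_iterM hst h1 h2 hy t) ⟨m + F.T, fun ω => by rw [hm]⟩,
      (hF.adm_Ψ t (k + 1) ht (by omega) hk).aemeasurable_mean hF.meas_ℛ measurable_matrix_inv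
        (F.aemeasurable_iterS hst h1 h2 hy t) ⟨s + F.T, fun ω => by rw [hs]⟩⟩

lemma Admissible.aemeas_update (hF : F.Admissible μ) (hst : State.AEMeas μ st)
    (hy : ∀ t, 1 ≤ t → AEMeasurable (y t) μ) {t : ℕ} (ht : F.T ≤ t) :
    State.AEMeas μ fun ω => F.update ω (fun k => y k ω) t (st ω) := by
  -- `finalM` and `finalS` come from iterate `N - 1`; iterate `N` is handed to the next time.
  obtain ⟨hΦ, hΨ⟩ := hF.aemeasurable_variational hst hy ht (F.N - 1) (by omega)
  obtain ⟨hΦ', hΨ'⟩ := hF.aemeasurable_variational hst hy ht F.N le_rfl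
  have hM := F.aemeasurable_iterM hst hΦ hΨ hy t
  have hS := F.aemeasurable_iterS hst hΦ hΨ hy t
  obtain ⟨m, hm⟩ := hst.m
  obtain ⟨s, hs⟩ := hst.s
  have hQ : AEMeasurable (fun ω => F.Qhat ω (fun k => y k ω) t (st ω)) μ :=
    (hF.adm_Q t ht).aemeasurable_mean hF.meas_𝒬 measurable_id hM
      ⟨m + F.T, fun ω => by rw [hm]⟩
  have hR : AEMeasurable (fun ω => F.Rhat ω (fun k => y k ω) t (st ω)) μ :=
    (hF.adm_R t ht).aemeasurable_mean hF.meas_ℛ measurable_id hS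
      ⟨s + F.T, fun ω => by rw [hs]⟩
  have hpred : AEMeasurable (fun ω => F.predCov ω (fun k => y k ω) t (st ω)) μ :=
    (aemeasurable_mul (aemeasurable_mul aemeasurable_const hst.P) aemeasurable_const).add hQ
  have hgain : AEMeasurable (fun ω => F.gain ω (fun k => y k ω) t (st ω)) μ :=
    aemeasurable_mul (aemeasurable_mul hpred aemeasurable_const) (aemeasurable_inv
      ((aemeasurable_mul (aemeasurable_mul aemeasurable_const hpred) aemeasurable_const).add hR))
  have hx : AEMeasurable (fun ω => F.A *ᵥ (st ω).x) μ :=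
    aemeasurable_mulVec aemeasurable_const hst.x
  exact
    { x := hx.add (aemeasurable_mulVec hgain ((hy _ (by omega)).sub
        (aemeasurable_mulVec aemeasurable_const hx)))
      P := aemeasurable_mul (aemeasurable_const.sub (aemeasurable_mul hgain aemeasurable_const))
        hpred
      M := hM.const_smul F.ρ
      S := hS.const_smul F.ρ
      Φ := hΦ'
      Ψ := hΨ'
      m := ⟨F.ρ * (m + F.T - nx - 1) + nx + 1, fun ω => by simp only [update, hm]⟩
      s := ⟨F.ρ * (s + F.T - ny - 1) + ny + 1, fun ω => by simp only [update, hs]⟩ }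

lemma Admissible.aemeas_state (hF : F.Admissible μ)
    (hy : ∀ t, 1 ≤ t → AEMeasurable (y t) μ) (n : ℕ) :
    State.AEMeas μ fun ω => F.state ω (fun k => y k ω) n := by
  induction n with
  | zero =>
    exact
      { x := aemeasurable_const
        P := aemeasurable_const
        M := aemeasurable_const
        S := aemeasurable_const
        Φ := hF.adm_Φ₀.aemeasurable_mean hF.meas_𝒬 measurable_matrix_inv aemeasurable_const
          ⟨_, fun _ => rfl⟩
        Ψ := hF.adm_Ψ₀.aemeasurable_mean hF.meas_ℛ measurable_matrix_inv aemeasurable_const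
          ⟨_, fun _ => rfl⟩
        m := ⟨_, fun _ => rfl⟩
        s := ⟨_, fun _ => rfl⟩ }
  | succ n ih => exact hF.aemeas_update ih hy (Nat.le_add_right _ _)

lemma Admissible.aemeasurable_estimate (hF : F.Admissible μ)
    (hy : ∀ t, 1 ≤ t → AEMeasurable (y t) μ) {t : ℕ} (ht : F.T ≤ t) :
    AEMeasurable (fun ω => F.estimate ω (fun k => y k ω) t) μ := by
  have hst := hF.aemeas_state hy (t - F.T)
  obtain ⟨hΦ, hΨ⟩ := hF.aemeasurable_variational hst hy ht (F.N - 1) (by omega)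
  exact aemeasurable_vecBlock (F.aemeasurable_winMean hst hΦ hΨ hy t) _

end VBFilter

end AEMeasurability

/-! ### Invariants of the filter and contraction of the prior error -/

namespace VBFilter

variable {Ω : Type*} {nx ny : ℕ} (F : VBFilter Ω nx ny)

/-- All integrators that the filter uses are meaningful at the outcome `ω`. -/
structure ProperAt (ω : Ω) : Prop where
  Φ₀ : F.intΦ₀.Proper ω F.𝒬
  Ψ₀ : F.intΨ₀.Proper ω F.ℛ
  Φ : ∀ t k, F.T ≤ t → 1 ≤ k → k ≤ F.N → (F.intΦ t k).Proper ω F.𝒬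
  Ψ : ∀ t k, F.T ≤ t → 1 ≤ k → k ≤ F.N → (F.intΨ t k).Proper ω F.ℛ
  Q : ∀ t, F.T ≤ t → (F.intQ t).Proper ω F.𝒬
  R : ∀ t, F.T ≤ t → (F.intR t).Proper ω F.ℛ

/-- The bounds on the inputs of the algorithm that are preserved by its recursion. -/
structure RegularState (θ : Vec nx → ℝ) (p a b β β' : ℝ) (st : State nx ny) : Prop where
  P : st.P.PosDef
  covBound : CovBound F.A b θ st.P
  P_le : ∀ u : Vec nx, u ⬝ᵥ st.P *ᵥ u ≤ p * (u ⬝ᵥ u)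
  M : st.M.PosDef
  S : st.S.PosDef
  m : (nx : ℝ) + 1 < st.m
  s : (ny : ℝ) + 1 < st.s
  Φ : Between b⁻¹ a⁻¹ st.Φ
  Ψ : Between β'⁻¹ β⁻¹ st.Ψ

variable {F} [MeasurableSpace Ω] {μ : Measure Ω}

lemma Admissible.ae_properAt (hF : F.Admissible μ) : ∀ᵐ ω ∂μ, F.ProperAt ω := by
  have h3 : ∀ᵐ ω ∂μ, ∀ t k, F.T ≤ t → 1 ≤ k → k ≤ F.N → (F.intΦ t k).Proper ω F.𝒬 := by
    simp only [ae_all_iff]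
    exact fun t k ht hk hN => (hF.adm_Φ t k ht hk hN).ae_proper
  have h4 : ∀ᵐ ω ∂μ, ∀ t k, F.T ≤ t → 1 ≤ k → k ≤ F.N → (F.intΨ t k).Proper ω F.ℛ := by
    simp only [ae_all_iff]
    exact fun t k ht hk hN => (hF.adm_Ψ t k ht hk hN).ae_proper
  have h5 : ∀ᵐ ω ∂μ, ∀ t, F.T ≤ t → (F.intQ t).Proper ω F.𝒬 := by
    simp only [ae_all_iff]
    exact fun t ht => (hF.adm_Q t ht).ae_proper
  have h6 : ∀ᵐ ω ∂μ, ∀ t, F.T ≤ t → (F.intR t).Proper ω F.ℛ := by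
    simp only [ae_all_iff]
    exact fun t ht => (hF.adm_R t ht).ae_proper
  filter_upwards [hF.adm_Φ₀.ae_proper, hF.adm_Ψ₀.ae_proper, h3, h4, h5, h6] with ω h1 h2 h3 h4 h5 h6
  exact ⟨h1, h2, h3, h4, h5, h6⟩

section Invariants

variable {θ : Vec nx → ℝ} {p a b β β' : ℝ} {ω : Ω} {st : State nx ny}

/-- Bounds on one iterate make the window covariance positive definite, hence also the new scale
matrices, and the next means are then averages over `𝒬` and `ℛ` with positive weights. -/
lemma Admissible.variational_between (hF : F.Admissible μ) (hω : F.ProperAt ω)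
    (ha : 0 < a) (hab : a ≤ b) (hβ : 0 < β) (hββ' : β ≤ β')
    (h𝒬 : LoewnerBounded F.𝒬 a b) (hℛ : LoewnerBounded F.ℛ β β')
    (hst : F.RegularState θ p a b β β' st) (y : ℕ → Vec ny) {t : ℕ} (ht : F.T ≤ t)
    (k : ℕ) (hk : k ≤ F.N) :
    Between b⁻¹ a⁻¹ (F.variational ω y t st k).1 ∧
      Between β'⁻¹ β⁻¹ (F.variational ω y t st k).2 := by
  have hb : 0 < b⁻¹ := inv_pos.2 (ha.trans_le hab)
  have hβ' : 0 < β'⁻¹ := inv_pos.2 (hβ.trans_le hββ')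
  have hT : (0 : ℝ) ≤ F.T := by positivity
  induction k with
  | zero => exact ⟨hst.Φ, hst.Ψ⟩
  | succ k ih =>
    obtain ⟨h1, h2⟩ := ih (by omega)
    have hcov := (F.winCov_posDef hst.P (h1.posDef hb) (h2.posDef hβ')).posSemidef
    exact ⟨(hω.Φ t (k + 1) ht (by omega) hk).mean_between hF.meas_𝒬 h𝒬 ha hF.vol_𝒬
        measurable_matrix_inv (fun G hG => (h𝒬.between hG).inv ha hab)
        (F.scaleM_posDef hst.M _ hcov) (by linarith [hst.m]),
      (hω.Ψ t (k + 1) ht (by omega) hk).mean_between hF.meas_ℛ hℛ hβ hF.vol_ℛ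
        measurable_matrix_inv (fun G hG => (hℛ.between hG).inv hβ hββ')
        (F.scaleS_posDef y t hst.S _ hcov) (by linarith [hst.s])⟩

lemma Admissible.final_between (hF : F.Admissible μ) (hω : F.ProperAt ω)
    (ha : 0 < a) (hab : a ≤ b) (hβ : 0 < β) (hββ' : β ≤ β')
    (h𝒬 : LoewnerBounded F.𝒬 a b) (hℛ : LoewnerBounded F.ℛ β β')
    (hst : F.RegularState θ p a b β β' st) (y : ℕ → Vec ny) {t : ℕ} (ht : F.T ≤ t) :
    (F.finalM ω y t st).PosDef ∧ (F.finalS ω y t st).PosDef ∧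
      Between a b (F.Qhat ω y t st) ∧ Between β β' (F.Rhat ω y t st) := by
  have hb : 0 < b⁻¹ := inv_pos.2 (ha.trans_le hab)
  have hβ' : 0 < β'⁻¹ := inv_pos.2 (hβ.trans_le hββ')
  have hT : (0 : ℝ) ≤ F.T := by positivity
  obtain ⟨h1, h2⟩ := hF.variational_between hω ha hab hβ hββ' h𝒬 hℛ hst y ht (F.N - 1) (by omega)
  have hcov := (F.winCov_posDef hst.P (h1.posDef hb) (h2.posDef hβ')).posSemidef
  have hM : (F.finalM ω y t st).PosDef := F.scaleM_posDef hst.M _ hcov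
  have hS : (F.finalS ω y t st).PosDef := F.scaleS_posDef y t hst.S _ hcov
  exact ⟨hM, hS,
    (hω.Q t ht).mean_between hF.meas_𝒬 h𝒬 ha hF.vol_𝒬 measurable_id
      (fun G hG => h𝒬.between hG) hM (by linarith [hst.m]),
    (hω.R t ht).mean_between hF.meas_ℛ hℛ hβ hF.vol_ℛ measurable_id
      (fun G hG => hℛ.between hG) hS (by linarith [hst.s])⟩

lemma Admissible.regularState_update (hF : F.Admissible μ) (hω : F.ProperAt ω)
    (ha : 0 < a) (hab : a ≤ b) (hβ : 0 < β) (hββ' : β ≤ β')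
    (h𝒬 : LoewnerBounded F.𝒬 a b) (hℛ : LoewnerBounded F.ℛ β β')
    {L : Matrix (Fin nx) (Fin ny) ℝ} (hθp : ∀ u : Vec nx, θ u ≤ p * (u ⬝ᵥ u))
    (hθ : ∀ u : Vec nx, β' * ((Lᵀ *ᵥ u) ⬝ᵥ (Lᵀ *ᵥ u)) + b * (u ⬝ᵥ u) +
      θ ((F.A - L * F.C)ᵀ *ᵥ u) ≤ θ u)
    (hst : F.RegularState θ p a b β β' st) (y : ℕ → Vec ny) {t : ℕ} (ht : F.T ≤ t) :
    F.RegularState θ p a b β β' (F.update ω y t st) := by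
  obtain ⟨hM, hS, hQ, hR⟩ := hF.final_between hω ha hab hβ hββ' h𝒬 hℛ hst y ht
  obtain ⟨h1, h2⟩ := hF.variational_between hω ha hab hβ hββ' h𝒬 hℛ hst y ht F.N le_rfl
  have hT : (0 : ℝ) ≤ F.T := by positivity
  exact
    { P := kalmanCov_posDef F.C (predCov_posDef F.A hst.P (hQ.posDef ha)) (hR.posDef hβ)
      covBound := CovBound.step F.C F.A hst.P hQ ha hR hβ L hθ hst.covBound
      P_le := fun u => (CovBound.form_le F.C F.A hst.P hQ ha hR hβ hst.covBound u).trans (hθp u)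
      M := hM.smul hF.ρ_pos
      S := hS.smul hF.ρ_pos
      -- Forgetting shrinks the excess over `nx + 1` by the factor `ρ`, which keeps it positive.
      m := by
        have := mul_pos hF.ρ_pos (show 0 < st.m + F.T - nx - 1 by linarith [hst.m])
        simp only [update]
        linarith
      s := by
        have := mul_pos hF.ρ_pos (show 0 < st.s + F.T - ny - 1 by linarith [hst.s])
        simp only [update]
        linarith
      Φ := h1
      Ψ := h2 }

lemma Admissible.regularState_state (hF : F.Admissible μ) (hω : F.ProperAt ω)
    (ha : 0 < a) (hab : a ≤ b) (hβ : 0 < β) (hββ' : β ≤ β')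
    (h𝒬 : LoewnerBounded F.𝒬 a b) (hℛ : LoewnerBounded F.ℛ β β')
    {L : Matrix (Fin nx) (Fin ny) ℝ} (hP₀ : CovBound F.A b θ F.P₀)
    (hP₀p : ∀ u : Vec nx, u ⬝ᵥ F.P₀ *ᵥ u ≤ p * (u ⬝ᵥ u))
    (hθp : ∀ u : Vec nx, θ u ≤ p * (u ⬝ᵥ u))
    (hθ : ∀ u : Vec nx, β' * ((Lᵀ *ᵥ u) ⬝ᵥ (Lᵀ *ᵥ u)) + b * (u ⬝ᵥ u) +
      θ ((F.A - L * F.C)ᵀ *ᵥ u) ≤ θ u) (y : ℕ → Vec ny) (n : ℕ) :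
    F.RegularState θ p a b β β' (F.state ω y n) := by
  induction n with
  | zero =>
    exact
      { P := hF.posDef_P₀
        covBound := hP₀
        P_le := hP₀p
        M := hF.posDef_M₀
        S := hF.posDef_S₀
        m := hF.lt_m₀
        s := hF.lt_s₀
        Φ := hω.Φ₀.mean_between hF.meas_𝒬 h𝒬 ha hF.vol_𝒬 measurable_matrix_inv
          (fun G hG => (h𝒬.between hG).inv ha hab) hF.posDef_M₀ hF.lt_m₀
        Ψ := hω.Ψ₀.mean_between hF.meas_ℛ hℛ hβ hF.vol_ℛ measurable_matrix_inv
          (fun G hG => (hℛ.between hG).inv hβ hββ') hF.posDef_S₀ hF.lt_s₀ }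
  | succ n ih =>
    exact hF.regularState_update hω ha hab hβ hββ' h𝒬 hℛ hθp hθ ih y (Nat.le_add_right _ _)

/-- One update contracts the error of the prior mean of the window, up to the noise. -/
lemma Admissible.update_contraction (hF : F.Admissible μ) (hω : F.ProperAt ω)
    (ha : 0 < a) (hab : a ≤ b) (hβ : 0 < β) (hββ' : β ≤ β') (hp : 0 < p)
    (h𝒬 : LoewnerBounded F.𝒬 a b) (hℛ : LoewnerBounded F.ℛ β β')
    (hθp : ∀ u : Vec nx, θ u ≤ p * (u ⬝ᵥ u))
    (hst : F.RegularState θ p a b β β' st) {y : ℕ → Vec ny} {t : ℕ} (ht : F.T ≤ t)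
    {x x' w : Vec nx} {v : Vec ny} (hx : x' = F.A *ᵥ x + w)
    (hy : y (t - F.T + 1) = F.C *ᵥ x' + v) :
    (x' - (F.update ω y t st).x) ⬝ᵥ (F.update ω y t st).P⁻¹ *ᵥ (x' - (F.update ω y t st).x) ≤
      (1 + a / (2 * p))⁻¹ * ((x - st.x) ⬝ᵥ st.P⁻¹ *ᵥ (x - st.x)) +
        (2 / a * (w ⬝ᵥ w) + β⁻¹ * (v ⬝ᵥ v)) := by
  obtain ⟨-, -, hQ, hR⟩ := hF.final_between hω ha hab hβ hββ' h𝒬 hℛ hst y ht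
  -- Here `δ = a / (2 * p)`, because `covBound` and `hθp` give `A P̄ Aᵀ ≤ p I`.
  refine kalman_contraction F.C F.A hst.P hQ ha hR hβ (by positivity) (fun u => ?_)
    (x - st.x) w v ?_
  · have h1 := hst.covBound u
    have h2 := hθp u
    have h3 := mul_nonneg (ha.trans_le hab).le (dotProduct_self_nonneg_real u)
    have h4 : (F.Aᵀ *ᵥ u) ⬝ᵥ st.P *ᵥ (F.Aᵀ *ᵥ u) ≤ p * (u ⬝ᵥ u) := by linarith
    calc a / (2 * p) * ((F.Aᵀ *ᵥ u) ⬝ᵥ st.P *ᵥ (F.Aᵀ *ᵥ u)) ≤ a / (2 * p) * (p * (u ⬝ᵥ u)) := by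
          gcongr
      _ = a / 2 * (u ⬝ᵥ u) := by field_simp
  · have hgain : kalmanGain F.C (F.A * st.P * F.Aᵀ + F.Qhat ω y t st) (F.Rhat ω y t st) =
        F.gain ω y t st := rfl
    simp only [hgain, update, hy, hx]
    simp only [sub_mulVec, one_mulVec, ← mulVec_mulVec, mulVec_add, mulVec_sub]
    abel

end Invariants

end VBFilter

/-! ### Second moments and contracting recursions of means -/

section Probability

variable {Ω : Type*} [MeasurableSpace Ω] {μ : Measure Ω}

lemma norm_toLp_sq {d : ℕ} (z : Vec d) : ‖WithLp.toLp 2 z‖ ^ 2 = z ⬝ᵥ z := by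
  rw [EuclideanSpace.norm_sq_eq]
  simp [dotProduct, sq]

lemma IsGaussianVec.aemeasurable {d : ℕ} {u : Ω → Vec d} {m : Vec d} {S : Mat d}
    (h : IsGaussianVec μ u m S) : AEMeasurable u μ :=
  (WithLp.measurable_ofLp 2 _).comp_aemeasurable (HasLaw.aemeasurable h)

/-- A Gaussian vector has a second moment, which depends only on its law. -/
lemma exists_secondMoment {d : ℕ} (m : Vec d) (S : Mat d) :
    ∃ c : ℝ, 0 ≤ c ∧ ∀ u : Ω → Vec d, IsGaussianVec μ u m S →
      Integrable (fun ω => u ω ⬝ᵥ u ω) μ ∧ ∫ ω, u ω ⬝ᵥ u ω ∂μ = c := by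
  have h_int : Integrable (fun z => ‖z‖ ^ 2) (multivariateGaussian (WithLp.toLp 2 m) S) :=
    IsGaussian.memLp_two_id.integrable_norm_pow two_ne_zero
  refine ⟨∫ z, ‖z‖ ^ 2 ∂(multivariateGaussian (WithLp.toLp 2 m) S),
    integral_nonneg fun _ => by positivity, fun u hu => ?_⟩
  have hlaw : HasLaw (fun ω => WithLp.toLp 2 (u ω))
    (multivariateGaussian (WithLp.toLp 2 m) S) μ := hu
  have hfun : (fun ω => u ω ⬝ᵥ u ω) = (fun z => ‖z‖ ^ 2) ∘ fun ω => WithLp.toLp 2 (u ω) := by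
    ext ω
    simp [← norm_toLp_sq]
  have hfm : AEStronglyMeasurable (fun z => ‖z‖ ^ 2)
      (multivariateGaussian (WithLp.toLp 2 m) S) := h_int.aestronglyMeasurable
  constructor
  · rw [hfun]
    rw [← hlaw.map_eq] at h_int
    exact h_int.comp_aemeasurable hlaw.aemeasurable
  · rw [hfun]
    exact hlaw.integral_comp hfm

/-- Means of a recursion that contracts up to a stationary disturbance stay bounded. -/
lemma exists_integral_le_of_contraction {B W : ℕ → Ω → ℝ} {g c : ℝ} (hg : 0 ≤ g) (hg1 : g < 1)
    (hB₀ : Integrable (B 0) μ) (hB : ∀ n ω, B (n + 1) ω = g * B n ω + W n ω)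
    (hW : ∀ n, Integrable (W n) μ ∧ ∫ ω, W n ω ∂μ ≤ c) :
    ∃ K, ∀ n, Integrable (B n) μ ∧ ∫ ω, B n ω ∂μ ≤ K := by
  have h1 : 0 < 1 - g := by linarith
  -- The second term is the fixed point of `K ↦ g * K + |c|`.
  refine ⟨|∫ ω, B 0 ω ∂μ| + |c| / (1 - g), fun n => ?_⟩
  induction n with
  | zero => exact ⟨hB₀, (le_abs_self _).trans (le_add_of_nonneg_right (by positivity))⟩
  | succ n ih =>
    have hfun : B (n + 1) = fun ω => g * B n ω + W n ω := funext (hB n)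
    have hi := ih.1.const_mul g
    rw [hfun]
    refine ⟨hi.add (hW n).1, ?_⟩
    rw [integral_add hi (hW n).1, integral_const_mul]
    have h2 := mul_le_mul_of_nonneg_left ih.2 hg
    have h3 := (hW n).2.trans (le_abs_self c)
    have h4 : |c| = (1 - g) * (|c| / (1 - g)) := by field_simp
    have h5 := mul_nonneg h1.le (abs_nonneg (∫ ω, B 0 ω ∂μ))
    linarith

end Probability

end VBMHE

end

/-! ### The mean-square bound -/

open VBMHE

theorem theorem1 {Ω : Type*} [MeasurableSpace Ω] (μ : Measure Ω) [IsProbabilityMeasure μ]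
    {nx ny : ℕ} (F : VBMHE.VBFilter Ω nx ny) (hF : F.Admissible μ)
    (Q : VBMHE.Mat nx) (R : VBMHE.Mat ny) (hQ : Q ∈ F.𝒬) (hR : R ∈ F.ℛ)
    (x : ℕ → Ω → VBMHE.Vec nx) (y : ℕ → Ω → VBMHE.Vec ny)
    (w : ℕ → Ω → VBMHE.Vec nx) (v : ℕ → Ω → VBMHE.Vec ny)
    (hsys : VBMHE.LinearGaussianSystem μ F.A F.C Q R F.x₀ F.P₀ x y w v)
    (A1 : VBMHE.Detectable F.A F.C)
    (A2 : ∃ a b : ℝ, 0 < a ∧ a ≤ b ∧ VBMHE.LoewnerBounded F.𝒬 a b)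
    (A3 : ∃ a b : ℝ, 0 < a ∧ a ≤ b ∧ VBMHE.LoewnerBounded F.ℛ a b) :
    ∃ c : ℝ, ∀ t : ℕ, F.T ≤ t →
      Integrable (fun ω =>
        ‖WithLp.toLp 2 (x t ω - F.estimate ω (fun k => y k ω) t)‖ ^ 2) μ ∧
      ∫ ω, ‖WithLp.toLp 2 (x t ω - F.estimate ω (fun k => y k ω) t)‖ ^ 2 ∂μ ≤ c := by
  obtain ⟨a, b, ha, hab, h𝒬⟩ := A2
  obtain ⟨β, β', hβ, hββ', hℛ⟩ := A3
  have hb := ha.trans_le hab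
  have hβ' := hβ.trans_le hββ'
  obtain ⟨L, θ, p, hp, hP₀, hP₀p, hθp, hθ⟩ :=
    exists_covBound F.C F.A F.P₀ hb.le hβ'.le A1
  obtain ⟨κ, hκ, hwin⟩ := F.exists_winError_le (φ' := a⁻¹) (ψ' := β⁻¹) hp
    (inv_pos.2 hb) (inv_pos.2 hβ')
  obtain ⟨cx, -, hcx⟩ := exists_secondMoment (μ := μ) F.x₀ F.P₀
  obtain ⟨cw, hcw0, hcw⟩ := exists_secondMoment (μ := μ) (0 : Vec nx) Q
  obtain ⟨cv, hcv0, hcv⟩ := exists_secondMoment (μ := μ) (0 : Vec ny) R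
  obtain ⟨q, hq0, hq⟩ := exists_form_le F.P₀⁻¹
  have hwm : ∀ n, Integrable (fun ω => w n ω ⬝ᵥ w n ω) μ ∧ ∫ ω, w n ω ⬝ᵥ w n ω ∂μ = cw :=
    fun n => hcw _ (hsys.law_w n)
  have hvm : ∀ n, Integrable (fun ω => v (n + 1) ω ⬝ᵥ v (n + 1) ω) μ ∧
      ∫ ω, v (n + 1) ω ⬝ᵥ v (n + 1) ω ∂μ = cv :=
    fun n => hcv _ (hsys.law_v (n + 1) (by omega))
  -- measurability of the states and the measurements
  have hxae : ∀ n, AEMeasurable (x n) μ := by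
    intro n
    induction n with
    | zero => exact hsys.law_x₀.aemeasurable
    | succ n ih =>
      rw [funext (hsys.state_eq n)]
      exact (aemeasurable_mulVec aemeasurable_const ih).add (hsys.law_w n).aemeasurable
  have hyae : ∀ t, 1 ≤ t → AEMeasurable (y t) μ := by
    intro t ht
    rw [funext fun ω => hsys.meas_eq t ω ht]
    exact (aemeasurable_mulVec aemeasurable_const (hxae t)).add (hsys.law_v t ht).aemeasurable
  -- a process with bounded means that dominates the error of the prior means
  set g : ℝ := (1 + a / (2 * p))⁻¹ with hg
  have hg0 : 0 ≤ g := by positivity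
  have hg1 : g < 1 := inv_lt_one_of_one_lt₀ (by linarith [show 0 < a / (2 * p) by positivity])
  have hmix : ∀ (s r : ℝ) (n : ℕ),
      Integrable (fun ω => s * (w n ω ⬝ᵥ w n ω) + r * (v (n + 1) ω ⬝ᵥ v (n + 1) ω)) μ ∧
      ∫ ω, (s * (w n ω ⬝ᵥ w n ω) + r * (v (n + 1) ω ⬝ᵥ v (n + 1) ω)) ∂μ = s * cw + r * cv := by
    intro s r n
    have h1 := (hwm n).1.const_mul s
    have h2 := (hvm n).1.const_mul r
    refine ⟨h1.add h2, ?_⟩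
    rw [integral_add h1 h2, integral_const_mul, integral_const_mul, (hwm n).2, (hvm n).2]
  -- The contraction inequality solved with equality. Being built from the noises and `x 0` alone,
  -- this majorant is visibly integrable, and the random inverse of `P̄` never has to be integrated.
  let B : ℕ → Ω → ℝ := fun n => Nat.rec
    (fun ω => q * (2 * (x 0 ω ⬝ᵥ x 0 ω) + 2 * (F.x₀ ⬝ᵥ F.x₀)))
    (fun n Bn ω => g * Bn ω +
      (2 / a * (w n ω ⬝ᵥ w n ω) + β⁻¹ * (v (n + 1) ω ⬝ᵥ v (n + 1) ω))) n
  obtain ⟨K, hK⟩ := exists_integral_le_of_contraction (μ := μ) (B := B) hg0 hg1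
    ((((hcx _ hsys.law_x₀).1.const_mul 2).add (integrable_const _)).const_mul q)
    (fun n ω => rfl) (fun n => ⟨(hmix (2 / a) β⁻¹ n).1, (hmix (2 / a) β⁻¹ n).2.le⟩)
  have hreg : ∀ ω, F.ProperAt ω → ∀ n,
      F.RegularState θ p a b β β' (F.state ω (fun k => y k ω) n) := fun ω hω n =>
    hF.regularState_state hω ha hab hβ hββ' h𝒬 hℛ hP₀ hP₀p hθp hθ _ n
  have hV : ∀ ω, F.ProperAt ω → ∀ n, (x n ω - (F.state ω (fun k => y k ω) n).x) ⬝ᵥ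
      (F.state ω (fun k => y k ω) n).P⁻¹ *ᵥ (x n ω - (F.state ω (fun k => y k ω) n).x) ≤
        B n ω := by
    intro ω hω n
    induction n with
    | zero =>
      refine (hq _).trans (mul_le_mul_of_nonneg_left ?_ hq0)
      have := add_dotProduct_self_le (x 0 ω) (-F.x₀)
      rwa [neg_dotProduct_neg, ← sub_eq_add_neg] at this
    | succ n ih =>
      have h1 := hF.update_contraction hω ha hab hβ hββ' hp h𝒬 hℛ hθp (hreg ω hω n)
        (y := fun k => y k ω) (Nat.le_add_right F.T n) (hsys.state_eq n ω) (v := v (n + 1) ω)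
        (by rw [Nat.add_sub_cancel_left]; exact hsys.meas_eq (n + 1) ω (by omega))
      refine h1.trans ?_
      exact add_le_add_left (mul_le_mul_of_nonneg_left ih hg0) _
  -- the error at the end of the window
  refine ⟨κ * (K + ∑ _i : Fin F.T, (a⁻¹ * cw + β⁻¹ * cv)), fun t ht => ?_⟩
  obtain ⟨n, rfl⟩ := Nat.exists_eq_add_of_le ht
  have hsumint : ∀ i ∈ (Finset.univ : Finset (Fin F.T)), Integrable (fun ω =>
      a⁻¹ * (w (n + i) ω ⬝ᵥ w (n + i) ω) + β⁻¹ * (v (n + i + 1) ω ⬝ᵥ v (n + i + 1) ω)) μ :=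
    fun i _ => (hmix _ _ _).1
  set D : Ω → ℝ := fun ω => κ * (B n ω + ∑ i : Fin F.T,
    (a⁻¹ * (w (n + i) ω ⬝ᵥ w (n + i) ω) + β⁻¹ * (v (n + i + 1) ω ⬝ᵥ v (n + i + 1) ω))) with hDdef
  have hDint : Integrable D μ :=
    ((hK n).1.add (integrable_finsetSum _ hsumint)).const_mul κ
  have hDle : ∫ ω, D ω ∂μ ≤ κ * (K + ∑ _i : Fin F.T, (a⁻¹ * cw + β⁻¹ * cv)) := by
    rw [hDdef, integral_const_mul, integral_add (hK n).1 (integrable_finsetSum _ hsumint),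
      integral_finsetSum _ hsumint]
    simp only [(hmix _ _ _).2]
    gcongr
    exact (hK n).2
  have hle : ∀ᵐ ω ∂μ,
      ‖WithLp.toLp 2 (x (F.T + n) ω - F.estimate ω (fun k => y k ω) (F.T + n))‖ ^ 2 ≤ D ω := by
    filter_upwards [hF.ae_properAt] with ω hω
    have hst := hreg ω hω n
    obtain ⟨hΦ, hΨ⟩ := hF.variational_between hω ha hab hβ hββ' h𝒬 hℛ hst (fun k => y k ω)
      (Nat.le_add_right F.T n) (F.N - 1) (by omega)
    -- The window at time `T + n` starts at time `n`; transition `i` carries the noises `w (n + i)`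
    -- and `v (n + i + 1)`.
    have h := hwin (fun k => y k ω) (F.T + n) _ _ _ (fun q => x (n + q.1) ω q.2)
      (fun i => w (n + i) ω) (fun i => v (n + i + 1) ω) hst.P hst.P_le hΦ hΨ
      (fun i => hsys.state_eq (n + i) ω)
      (fun i => by rw [Nat.add_sub_cancel_left]; exact hsys.meas_eq (n + i + 1) ω (by omega))
    have hlast : x (F.T + n) ω - F.estimate ω (fun k => y k ω) (F.T + n) =
        WinVec.block ((fun q => x (n + q.1) ω q.2) -
          F.winMean (fun k => y k ω) (F.T + n) (F.state ω (fun k => y k ω) n)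
            (F.variational ω (fun k => y k ω) (F.T + n) (F.state ω (fun k => y k ω) n)
              (F.N - 1)).1
            (F.variational ω (fun k => y k ω) (F.T + n) (F.state ω (fun k => y k ω) n)
              (F.N - 1)).2) (Fin.last F.T) := by
      rw [WinVec.block_sub, VBFilter.estimate, Nat.add_sub_cancel_left, add_comm F.T n]
      rfl
    rw [norm_toLp_sq, hlast]
    refine h.trans (mul_le_mul_of_nonneg_left (add_le_add_left (hV ω hω n) _) hκ)
  have hmeas : AEStronglyMeasurable (fun ω =>
      ‖WithLp.toLp 2 (x (F.T + n) ω - F.estimate ω (fun k => y k ω) (F.T + n))‖ ^ 2) μ := by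
    have h1 := (hxae (F.T + n)).sub (hF.aemeasurable_estimate hyae ht)
    have h2 := (WithLp.measurable_toLp 2 (Fin nx → ℝ)).comp_aemeasurable h1
    exact (h2.norm.pow_const 2).aestronglyMeasurable
  have h_int : Integrable (fun ω =>
      ‖WithLp.toLp 2 (x (F.T + n) ω - F.estimate ω (fun k => y k ω) (F.T + n))‖ ^ 2) μ := by
    refine hDint.mono' hmeas ?_
    filter_upwards [hle] with ω hω
    rwa [Real.norm_of_nonneg (by positivity)]
  exact ⟨h_int, (integral_mono_ae h_int hDint hle).trans hDle⟩
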